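/- Let $a>0$. For $z\in\mathbb{C}\setminus(-\infty,0]$ and $\lambda\in\mathbb{C}^*$ put $$y_0(z,\lambda)=\sum_{j\ge 0}\frac{\lambda^{-2j}z^{4j}}{16^j(j!)^2},\qquad y_1(z,\lambda)=-2\lambda^{-1}\sum_{j\ge 1}\Bigl(1+\tfrac12+\cdots+\tfrac1j\Bigr)\frac{\lambda^{-2j}z^{4j}}{16^j(j!)^2},$$ $$L(z,\lambda)=\begin{pmatrix}1&0\\ \lambda^{-1}\log\frac z2&1\end{pmatrix}\begin{pmatrix}y_0&\lambda z\,\partial_z y_0\\ \frac14y_1&y_0+\frac14\lambda z\,\partial_z y_1\end{pmatrix},\qquad \phi(z,\lambda)=\begin{pmatrix}\sqrt{-a}&-\lambda/\sqrt{-a}\\0&1/\sqrt{-a}\end{pmatrix}L(z,\lambda),$$ with the principal logarithm and $\sqrt{-a}=i\sqrt a$. Let $(\Lambda \mathrm{SL}_2\mathbb{C})_\sigma$ be the set of smooth maps $\gamma:S^1\to \mathrm{SL}_2\mathbb{C}$ with $\gamma(-\lambda)=\mathrm{diag}(1,-1)\,\gamma(\lambda)\,\mathrm{diag}(1,-1)$.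 Let $(\Lambda \mathrm{SU}_{1,1})_\sigma$ be the subset of those $\gamma$ with values in $\mathrm{SU}_{1,1}=\{A\in \mathrm{SL}_2\mathbb{C}:\overline{A}^{\,t}\,\mathrm{diag}(1,-1)\,A=\mathrm{diag}(1,-1)\}$. Let $(\Lambda^{+,>0}\mathrm{SL}_2\mathbb{C})_\sigma$ be the subset of those $\gamma$ that extend to a continuous map from the closed unit disc to $\mathrm{SL}_2\mathbb{C}$ which is holomorphic in the open disc and whose value at $\lambda=0$ is $\mathrm{diag}(\rho,\rho^{-1})$ for some $\rho>0$. Then $\phi$ admits an Iwasawa factorization on some neighbourhood of $z=0$ in $\mathbb{C}\setminus(-\infty,0]$: there are a neighbourhood $U$ of $0$ in $\mathbb{C}$ and, for every $z\in U\setminus(-\infty,0]$, loops $F(z,\cdot)\in(\Lambda \mathrm{SU}_{1,1})_\sigma$ and $B(z,\cdot)\in(\Lambda^{+,>0}\mathrm{SL}_2\mathbb{C})_\sigma$ such that $$\phi(z,\lambda)=F(z,\lambda)\begin{pmatrix}0&\lambda\\-\lambda^{-1}&0\end{pmatrix}B(z,\lambda)\qquad\text{for all }\lambda\in S^1 .$$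 -/

import Mathlib

open scoped ContDiff Manifold Topology Matrix

noncomputable section

namespace IwasawaSmyth

/-- `SL₂(ℂ)`. -/
abbrev SL2C : Type := Matrix.SpecialLinearGroup (Fin 2) ℂ

/-- The matrix `diag(1, -1)`. -/
def J : Matrix (Fin 2) (Fin 2) ℂ := !![1, 0; 0, -1]

/-- The involution `σ(γ) = diag(1,-1) γ diag(1,-1)` of `M₂(ℂ)`. -/
def sigma (γ : Matrix (Fin 2) (Fin 2) ℂ) : Matrix (Fin 2) (Fin 2) ℂ := J * γ * J

/-- The twisted loop group `(Λ SL₂ℂ)_σ`: smooth maps `γ : S¹ → SL₂(ℂ)` (smoothness is read off the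
matrix entries) with `γ(-l) = σ(γ(l))`. -/
def LoopSL : Set (Circle → SL2C) :=
  {γ | (∀ i j, ContMDiff (𝓡 1) 𝓘(ℝ, ℂ) ∞ (fun l : Circle => (γ l).1 i j)) ∧
    ∀ l : Circle, (γ (-l)).1 = sigma (γ l).1}

/-- `Γ` restricts on the closed unit disc to an extension of the loop `γ` with values in `SL₂(ℂ)`,
continuous on the closed disc and holomorphic in the open disc. The values of `Γ` outside the closed
disc are irrelevant. -/
def IsDiscExtension (γ : Circle → SL2C) (Γ : ℂ → SL2C) : Prop :=
  (∀ i j, DiffContOnCl ℂ (fun l : ℂ => (Γ l).1 i j) (Metric.ball 0 1)) ∧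
    ∀ l : Circle, Γ (l : ℂ) = γ l

/-- `(Λ^{+,>0} SL₂ℂ)_σ`: the twisted loops that extend holomorphically to the unit disc with values
in `SL₂(ℂ)`, and whose value at the centre is `diag(ρ, ρ⁻¹)` for some `ρ > 0`. -/
def LoopSLPlusPos : Set (Circle → SL2C) :=
  {γ | γ ∈ LoopSL ∧ ∃ Γ : ℂ → SL2C, IsDiscExtension γ Γ ∧
    ∃ ρ : ℝ, 0 < ρ ∧ (Γ 0).1 = !![(ρ : ℂ), 0; 0, (ρ : ℂ)⁻¹]}

/-- `SU₁,₁`, the matrices of determinant one that preserve the Hermitian form `diag(1,-1)`. -/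
def SU11 : Set SL2C := {A | A.1ᴴ * J * A.1 = J}

/-- `(Λ SU₁,₁)_σ`. -/
def LoopSU11 : Set (Circle → SL2C) := {γ | γ ∈ LoopSL ∧ ∀ l, γ l ∈ SU11}

/-- The loop `w = [[0, l], [-l⁻¹, 0]]`. -/
def w (l : ℂ) : Matrix (Fin 2) (Fin 2) ℂ := !![0, l; -l⁻¹, 0]

/-- `y₀(z, l) = ∑_{j ≥ 0} l^{-2j} z^{4j} / (16^j (j!)²)`. -/
def y0 (z l : ℂ) : ℂ :=
  ∑' j : ℕ, l⁻¹ ^ (2 * j) * z ^ (4 * j) / (16 ^ j * (j.factorial : ℂ) ^ 2)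

/-- `y₁(z, l) = -2 l⁻¹ ∑_{j ≥ 1} (1 + ⋯ + 1/j) l^{-2j} z^{4j} / (16^j (j!)²)`; the term `j = 0`
below is zero because `harmonic 0 = 0`. -/
def y1 (z l : ℂ) : ℂ :=
  -2 * l⁻¹ * ∑' j : ℕ, ((harmonic j : ℚ) : ℂ) *
    (l⁻¹ ^ (2 * j) * z ^ (4 * j) / (16 ^ j * (j.factorial : ℂ) ^ 2))

/-- The canonical solution `L(z, l)`, with the principal logarithm and with `∂/∂z` in the second
column. -/
def L (z l : ℂ) : Matrix (Fin 2) (Fin 2) ℂ :=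
  !![1, 0; l⁻¹ * Complex.log (z / 2), 1] *
  !![y0 z l, l * z * deriv (fun ζ => y0 ζ l) z;
     (1 / 4) * y1 z l, y0 z l + l * z * (1 / 4) * deriv (fun ζ => y1 ζ l) z]

/-- The square root `√(-a)` (principal branch, that is `i √a` for `a > 0`). -/
def sqrtNeg (a : ℝ) : ℂ := (-(a : ℂ)) ^ (1 / 2 : ℂ)

/-- The dressed solution `φ = [[√(-a), -l/√(-a)], [0, 1/√(-a)]] L`. -/
def phi (a : ℝ) (z l : ℂ) : Matrix (Fin 2) (Fin 2) ℂ :=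
  !![sqrtNeg a, -l / sqrtNeg a; 0, 1 / sqrtNeg a] * L z l

end IwasawaSmyth

end

/-!
The proof rests on an explicit factorization of `φ` into a part that carries the logarithm and the
middle term `w`, and a part that tends to the identity as `z → 0`.

Put `T = -(a + 2 log |z/2|)`, which is large for small `z`, `r = √T`, and let `M` be `L` without its
logarithmic factor. With the plus loop `B₀ = [[r, -l/r], [0, 1/r]]` one has `φ = A N B₀`, where
`N = B₀ M B₀⁻¹` (`phi_eq`). The choice of `T` gives `Aᴴ J A = -J` on the unit circle
(`leadingPart_conj`), and also `wᴴ J w = -J`, so `A w⁻¹` is a loop in `SU₁,₁`.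

The loop `N` is a power series in `s = l⁻¹` with `N(s = 0) = 1`, and its distance to `1` on
`|s| = 2` is `O(T |z|⁴) = O(|z|³)` (`exists_norm_conjugatedLoop_sub_one_le`). That `det N = 1` is
the Wronskian identity for the two series of Bessel type (`bessel_wronskian`).

It remains to find a plus loop `P` with `Pᴴ J P = Nᴴ J N` on the circle, since then `B = P B₀` and
`F = A N P⁻¹ w⁻¹` are as required. In terms of the adjoint `τ(X) = J Xᴴ J` the equation is
`τ(P) P = τ(N) N`. For `P = 1 + X`, comparison of the Fourier coefficients of nonnegative index
turns it into a fixed point equation for the coefficients of `X`, which is a contraction in the norm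
`sup ‖xₙ‖ 2ⁿ` (`exists_correlation_fixedPoint`, `exists_spectral_factorization`); the coefficients
of negative index follow by applying `τ`. The weight `2ⁿ` makes `P` holomorphic beyond the closed
disc, whence smoothness on the circle. The twisting condition is closed and is preserved by the
iteration. Finally `|det P| = 1` on the circle while `det P` has no zero in the disc, so `det P` is
constant by the maximum principle, and it is `1` because `P(0)` is diagonal with positive entries
(`exists_plus_factor`).
-/

namespace IwasawaSmyth

/-! ### Quadratic correlation equations in a Banach algebra -/

section Correlation

variable {A : Type*} [NormedRing A]

/-- The correlation `∑ₖ τ(xₖ) y_{n+k}` of two sequences. When `τ` is a conjugate-linear involution,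
`correlation τ x x n` with `n ≥ 0` is the coefficient of `lⁿ` in `τ(X) X` for `X = ∑ xₙ lⁿ` on the
unit circle. -/
noncomputable def correlation (τ : A → A) (x y : ℕ → A) (n : ℕ) : A :=
  ∑' k, τ (x k) * y (n + k)

lemma norm_correlation_term_le {τ : A → A} (hτ : ∀ a, ‖τ a‖ = ‖a‖) {x y : ℕ → A} {a b : ℝ}
    (hx : ∀ k, ‖x k‖ ≤ a / 2 ^ k) (hy : ∀ k, ‖y k‖ ≤ b / 2 ^ k) (n k : ℕ) :
    ‖τ (x k) * y (n + k)‖ ≤ a * b / 2 ^ n * (1 / 4) ^ k := by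
  have ha : 0 ≤ a / 2 ^ k := (norm_nonneg _).trans (hx k)
  calc ‖τ (x k) * y (n + k)‖ ≤ ‖x k‖ * ‖y (n + k)‖ := by
        simpa [hτ] using norm_mul_le (τ (x k)) (y (n + k))
    _ ≤ a / 2 ^ k * (b / 2 ^ (n + k)) := by gcongr; exacts [hx k, hy _]
    _ = _ := by
        have h4 : (4 : ℝ) ^ k = 2 ^ k * 2 ^ k := by rw [← mul_pow]; norm_num
        rw [pow_add, one_div, inv_pow, h4, div_mul_div_comm, ← div_eq_mul_inv, div_div]
        ring_nf

lemma hasSum_geometric_quarter (c : ℝ) : HasSum (fun k : ℕ => c * (1 / 4) ^ k) (4 / 3 * c) := by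
  have := (hasSum_geometric_of_lt_one (r := 1 / 4) (by norm_num) (by norm_num)).mul_left c
  rwa [show c * (1 - 1 / 4)⁻¹ = 4 / 3 * c by ring] at this

lemma norm_correlation_le {τ : A → A} (hτ : ∀ a, ‖τ a‖ = ‖a‖) {x y : ℕ → A} {a b : ℝ}
    (hx : ∀ k, ‖x k‖ ≤ a / 2 ^ k) (hy : ∀ k, ‖y k‖ ≤ b / 2 ^ k) (n : ℕ) :
    ‖correlation τ x y n‖ ≤ 4 / 3 * (a * b) / 2 ^ n := by
  have := tsum_of_norm_bounded (hasSum_geometric_quarter _) (norm_correlation_term_le hτ hx hy n)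
  rwa [← mul_div_assoc] at this

variable [CompleteSpace A]

lemma summable_correlation {τ : A → A} (hτ : ∀ a, ‖τ a‖ = ‖a‖) {x y : ℕ → A} {a b : ℝ}
    (hx : ∀ k, ‖x k‖ ≤ a / 2 ^ k) (hy : ∀ k, ‖y k‖ ≤ b / 2 ^ k) (n : ℕ) :
    Summable fun k => τ (x k) * y (n + k) :=
  Summable.of_norm_bounded (hasSum_geometric_quarter _).summable
    (norm_correlation_term_le hτ hx hy n)

/-- The polarisation behind the contraction estimate for the quadratic map
`x ↦ correlation τ x x`. -/
lemma norm_correlation_sub_le {τ : A →+ A} (hτ : ∀ a, ‖τ a‖ = ‖a‖) {x y : ℕ → A} {a d : ℝ}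
    (hx : ∀ k, ‖x k‖ ≤ a / 2 ^ k) (hy : ∀ k, ‖y k‖ ≤ a / 2 ^ k)
    (hxy : ∀ k, ‖x k - y k‖ ≤ d / 2 ^ k) (n : ℕ) :
    ‖correlation τ x x n - correlation τ y y n‖ ≤ 8 / 3 * (a * d) / 2 ^ n := by
  have key : correlation τ x x n - correlation τ y y n =
      correlation τ (fun k => x k - y k) x n + correlation τ y (fun k => x k - y k) n := by
    unfold correlation
    rw [← (summable_correlation hτ hx hx n).tsum_sub (summable_correlation hτ hy hy n),
      ← (summable_correlation hτ hxy hx n).tsum_add (summable_correlation hτ hy hxy n)]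
    congr 1; ext k
    simp only [map_sub]; noncomm_ring
  rw [key]
  calc _ ≤ _ := norm_add_le _ _
    _ ≤ _ := add_le_add (norm_correlation_le hτ hxy hx n) (norm_correlation_le hτ hy hxy n)
    _ = _ := by ring

/-- An automorphism commuting with `τ` under which `xₙ` has parity `n` gives the correlations the
same parity. -/
lemma map_correlation {τ : A →+ A} (hτ : ∀ a, ‖τ a‖ = ‖a‖) {κ : A →+* A} (hκ : Continuous κ)
    (hκτ : ∀ a, κ (τ a) = τ (κ a)) {x y : ℕ → A} {a b : ℝ}
    (hx : ∀ k, ‖x k‖ ≤ a / 2 ^ k) (hy : ∀ k, ‖y k‖ ≤ b / 2 ^ k)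
    (hx' : ∀ n, κ (x n) = (-1) ^ n * x n) (hy' : ∀ n, κ (y n) = (-1) ^ n * y n) (n : ℕ) :
    κ (correlation τ x y n) = (-1) ^ n * correlation τ x y n := by
  unfold correlation
  have hs := summable_correlation hτ hx hy n
  rw [hs.map_tsum κ hκ, ← hs.tsum_mul_left]
  congr 1; ext k
  rw [map_mul, hκτ, hx', hy', pow_add]
  rcases neg_one_pow_eq_or A k with hk | hk <;> rcases neg_one_pow_eq_or A n with hn | hn <;>
    simp [hk, hn]

variable [NormedAlgebra ℂ A]

open BoundedContinuousFunction in
/-- The Banach fixed point theorem in the space of sequences with `sup ‖xₙ‖ 2ⁿ < ∞`, on the ball of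
radius `1/8`. The factor `1/2` at `n = 0` and the factor `1` at `n ≥ 1` invert the linear part
`X ↦ X + τ(X)` of the equation `(1 + τ(X)) (1 + X) = 1 + E`. -/
lemma exists_correlation_fixedPoint {τ : A →+ A} (hτ : ∀ a, ‖τ a‖ = ‖a‖) {κ : A →+* A}
    (hκ : Continuous κ) (hκτ : ∀ a, κ (τ a) = τ (κ a)) (hκs : ∀ (c : ℂ) a, κ (c • a) = c • κ a)
    {E : ℕ → A} (hE : ∀ n, ‖E n‖ ≤ 1 / 16 / 2 ^ n) (hκE : ∀ n, κ (E n) = (-1) ^ n * E n) :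
    ∃ x : ℕ → A, (∀ n, ‖x n‖ ≤ 1 / 8 / 2 ^ n) ∧ (∀ n, κ (x n) = (-1) ^ n * x n) ∧
      ∀ n, x n = (if n = 0 then (1 / 2 : ℂ) else 1) • (E n - correlation τ x x n) := by
  set c : ℕ → ℂ := fun n => if n = 0 then (1 / 2 : ℂ) else 1 with hc
  have hc1 : ∀ n, ‖c n‖ ≤ 1 := by intro n; by_cases h : n = 0 <;> simp [hc, h]; norm_num
  -- The sequence `xₙ = 2⁻ⁿ qₙ` attached to a bounded sequence `q`.
  let X : (ℕ →ᵇ A) → ℕ → A := fun q n => ((2 : ℂ) ^ n)⁻¹ • q n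
  have hnX : ∀ (y : A) (n : ℕ), ‖((2 : ℂ) ^ n)⁻¹ • y‖ = ‖y‖ / 2 ^ n := by
    intro y n; rw [norm_smul, norm_inv, norm_pow]; simp [div_eq_inv_mul]
  have hX : ∀ q n, ‖X q n‖ ≤ ‖q‖ / 2 ^ n := fun q n => by
    rw [hnX]; gcongr; exact q.norm_coe_le_norm n
  have hXsub : ∀ q q' n, ‖X q n - X q' n‖ ≤ dist q q' / 2 ^ n := fun q q' n => by
    simp only [X]
    rw [← smul_sub, hnX, dist_eq_norm]; gcongr; exact (q - q').norm_coe_le_norm n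
  let G : (ℕ →ᵇ A) → ℕ → A := fun q n =>
    (2 : ℂ) ^ n • c n • (E n - correlation τ (X q) (X q) n)
  have hcs : ∀ (y : A) (n : ℕ) (r : ℝ), ‖y‖ ≤ r / 2 ^ n → ‖(2 : ℂ) ^ n • c n • y‖ ≤ r := by
    intro y n r hy
    have h2 : (0 : ℝ) < 2 ^ n := by positivity
    calc ‖(2 : ℂ) ^ n • c n • y‖ = 2 ^ n * (‖c n‖ * ‖y‖) := by simp [norm_smul]
      _ ≤ 2 ^ n * (1 * (r / 2 ^ n)) := by gcongr; exact hc1 n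
      _ = r := by field_simp
  have hG : ∀ q n, ‖G q n‖ ≤ 1 / 16 + 4 / 3 * (‖q‖ * ‖q‖) := fun q n => by
    refine hcs _ _ _ ?_
    rw [add_div]
    exact (norm_sub_le _ _).trans (add_le_add (hE n) (norm_correlation_le hτ (hX q) (hX q) n))
  let Φ : (ℕ →ᵇ A) → (ℕ →ᵇ A) := fun q => ofNormedAddCommGroupDiscrete (G q) _ (hG q)
  have hΦ : ∀ q n, Φ q n = G q n := fun q n => rfl
  let s : Set (ℕ →ᵇ A) := Metric.closedBall 0 (1 / 8) ∩ ⋂ n, {q | κ (q n) = (-1) ^ n * q n}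
  have hs : IsComplete s := by
    refine (Metric.isClosed_closedBall.inter (isClosed_iInter fun n => ?_)).isComplete
    exact isClosed_eq (hκ.comp (continuous_eval_const n))
      (continuous_const.mul (continuous_eval_const n))
  have hsn : ∀ q ∈ s, ‖q‖ ≤ 1 / 8 := fun q hq => by simpa using hq.1
  have hsκ : ∀ q ∈ s, ∀ n, κ (X q n) = (-1) ^ n * X q n := fun q hq n => by
    simp only [X]
    rw [hκs, Set.mem_iInter.1 hq.2 n, mul_smul_comm]
  have hmaps : Set.MapsTo Φ s s := by
    intro q hq
    refine ⟨?_, Set.mem_iInter.2 fun n => ?_⟩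
    · rw [mem_closedBall_zero_iff, norm_le (by norm_num)]
      intro n
      refine (hG q n).trans ?_
      nlinarith [hsn q hq, norm_nonneg q]
    · change κ (G q n) = (-1) ^ n * G q n
      simp only [G]
      rw [hκs, hκs, map_sub, hκE, map_correlation hτ hκ hκτ (hX q) (hX q) (hsκ q hq) (hsκ q hq),
        ← mul_sub, mul_smul_comm, mul_smul_comm]
  have hcontr : ContractingWith (1 / 2) (hmaps.restrict Φ s s) := by
    refine ⟨by norm_num, LipschitzWith.of_dist_le_mul ?_⟩
    rintro ⟨q, hq⟩ ⟨q', hq'⟩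
    change dist (Φ q) (Φ q') ≤ _ * dist q q'
    rw [dist_le (by positivity)]
    intro n
    rw [hΦ, hΦ, dist_eq_norm]
    have h8 : ∀ p ∈ s, ∀ k, ‖X p k‖ ≤ 1 / 8 / 2 ^ k := fun p hp k =>
      (hX p k).trans (by gcongr; exact hsn p hp)
    have h := norm_correlation_sub_le hτ (h8 q' hq') (h8 q hq) (hXsub q' q) n
    rw [dist_comm] at h
    have e : G q n - G q' n = (2 : ℂ) ^ n • c n •
        (correlation τ (X q') (X q') n - correlation τ (X q) (X q) n) := by
      simp only [G]
      rw [← smul_sub, ← smul_sub, sub_sub_sub_cancel_left]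
    rw [e]
    refine (hcs _ _ _ h).trans ?_
    have := dist_nonneg (x := q) (y := q')
    push_cast
    linarith
  obtain ⟨q, hqs, hq, -⟩ := hcontr.exists_fixedPoint' hs hmaps
    (x := 0) (by simp [s]) (edist_ne_top _ _)
  refine ⟨X q, fun n => (hX q n).trans (by gcongr; exact hsn q hqs), hsκ q hqs, fun n => ?_⟩
  have h : q n = G q n := by rw [← hΦ, hq]
  change ((2 : ℂ) ^ n)⁻¹ • q n = _
  rw [h]
  simp only [G]
  rw [inv_smul_smul₀ (pow_ne_zero _ two_ne_zero)]

end Correlation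

/-! ### Spectral factorization near the identity -/

/-- Pairs of natural numbers, sorted by their difference: `(j, k)` with `j ≤ k` is `(k, n + k)` for
`n ≥ 0`, and `(j, k)` with `k < j` is `(n + 1 + k, k)`. -/
def pairsByDifference : (ℕ × ℕ) ⊕ (ℕ × ℕ) ≃ ℕ × ℕ where
  toFun := Sum.elim (fun q => (q.2, q.1 + q.2)) (fun q => (q.1 + 1 + q.2, q.2))
  invFun q := if q.1 ≤ q.2 then Sum.inl (q.2 - q.1, q.1) else Sum.inr (q.1 - q.2 - 1, q.2)
  left_inv := by
    rintro (⟨n, k⟩ | ⟨n, k⟩)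
    · simp
    · change (if n + 1 + k ≤ k then _ else Sum.inr (n + 1 + k - k - 1, k)) = _
      rw [if_neg (by omega)]
      congr 2; omega
  right_inv := by
    rintro ⟨j, k⟩
    by_cases h : j ≤ k
    · simp [h]
    · simp only [h, if_false, Sum.elim_inr, Prod.mk.injEq, and_true]
      omega

section Factorization

variable {A : Type*} [NormedRing A]

lemma summable_norm_of_le {x : ℕ → A} {a : ℝ} (hx : ∀ k, ‖x k‖ ≤ a / 2 ^ k) :
    Summable fun k => ‖x k‖ := by
  refine Summable.of_nonneg_of_le (fun _ => norm_nonneg _) hx ?_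
  simpa [div_eq_mul_inv, inv_pow] using
    (summable_geometric_of_lt_one (r := (2 : ℝ)⁻¹) (by norm_num) (by norm_num)).mul_left a

variable [CompleteSpace A]

/-- The product `τ(X) X` of a sum with its conjugate, arranged by correlations. -/
lemma map_tsum_mul_tsum {τ : A →+ A} (hτ : ∀ a, ‖τ a‖ = ‖a‖) (hττ : ∀ a, τ (τ a) = a)
    (hτm : ∀ a b, τ (a * b) = τ b * τ a) {x : ℕ → A} {a : ℝ} (hx : ∀ k, ‖x k‖ ≤ a / 2 ^ k) :
    τ (∑' k, x k) * ∑' k, x k = correlation τ x x 0 +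
      ∑' n, (correlation τ x x (n + 1) + τ (correlation τ x x (n + 1))) := by
  have hτc : Continuous τ := (AddMonoidHomClass.isometry_of_norm τ hτ).continuous
  have hn := summable_norm_of_le hx
  have hn' : Summable fun k => ‖τ (x k)‖ := by simpa only [hτ] using hn
  rw [hn.of_norm.map_tsum τ hτc, tsum_mul_tsum_of_summable_norm hn' hn,
    ← pairsByDifference.tsum_eq]
  have hs := pairsByDifference.summable_iff.2 (summable_mul_of_summable_norm hn' hn)
  have h1 : Summable fun q : ℕ × ℕ => τ (x q.2) * x (q.1 + q.2) :=
    (hs.comp_injective Sum.inl_injective).congr fun _ => rfl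
  have h2 : Summable fun q : ℕ × ℕ => τ (x (q.1 + 1 + q.2)) * x q.2 :=
    (hs.comp_injective Sum.inr_injective).congr fun _ => rfl
  have hflip : ∀ n, ∑' k, τ (x (n + 1 + k)) * x k = τ (correlation τ x x (n + 1)) := by
    intro n
    unfold correlation
    rw [(summable_correlation hτ hx hx (n + 1)).map_tsum τ hτc]
    simp only [hτm, hττ]
  have hc : Summable fun n => correlation τ x x n := h1.prod
  have hc' : Summable fun n => τ (correlation τ x x (n + 1)) := by
    simpa only [hflip] using h2.prod
  have hsplit : ∑' c, τ (x (pairsByDifference c).1) * x (pairsByDifference c).2 =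
      ∑' q : ℕ × ℕ, τ (x q.2) * x (q.1 + q.2) +
        ∑' q : ℕ × ℕ, τ (x (q.1 + 1 + q.2)) * x q.2 :=
    Summable.tsum_sum (f := fun c => τ (x (pairsByDifference c).1) * x (pairsByDifference c).2)
      h1 h2
  rw [hsplit, h1.tsum_prod, h2.tsum_prod]
  simp only [hflip]
  change ∑' n, correlation τ x x n + _ = _
  rw [hc.tsum_eq_zero_add, Summable.tsum_add ((summable_nat_add_iff 1).2 hc) hc', add_assoc]

variable [NormedAlgebra ℂ A]

/-- On the unit circle, `τ(X(l)) X(l)` for `X(l) = ∑ xₖ lᵏ` has the correlations of `x` as its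
Fourier coefficients. -/
lemma map_tsum_mul_tsum_circle {τ : A →+ A} (hτ : ∀ a, ‖τ a‖ = ‖a‖) (hττ : ∀ a, τ (τ a) = a)
    (hτm : ∀ a b, τ (a * b) = τ b * τ a) (hτs : ∀ (c : ℂ) a, τ (c • a) = star c • τ a)
    {x : ℕ → A} {a : ℝ} (hx : ∀ k, ‖x k‖ ≤ a / 2 ^ k) (l : Circle) :
    τ (∑' k, (l : ℂ) ^ k • x k) * ∑' k, (l : ℂ) ^ k • x k = correlation τ x x 0 +
      ∑' n, ((l : ℂ) ^ (n + 1) • correlation τ x x (n + 1) +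
        (l : ℂ)⁻¹ ^ (n + 1) • τ (correlation τ x x (n + 1))) := by
  have hl : star (l : ℂ) = (l : ℂ)⁻¹ := by
    rw [← Circle.coe_inv, Circle.coe_inv_eq_conj]; rfl
  have hx' : ∀ k, ‖(l : ℂ) ^ k • x k‖ ≤ a / 2 ^ k := fun k => by
    simpa [norm_smul, Circle.norm_coe] using hx k
  have hcorr : ∀ n, correlation τ (fun k => (l : ℂ) ^ k • x k) (fun k => (l : ℂ) ^ k • x k) n =
      (l : ℂ) ^ n • correlation τ x x n := by
    intro n
    unfold correlation
    rw [← (summable_correlation hτ hx hx n).tsum_const_smul]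
    congr 1; ext k
    rw [hτs, star_pow, hl, smul_mul_smul_comm, pow_add, mul_comm ((l : ℂ) ^ n), ← mul_assoc,
      inv_pow, inv_mul_cancel₀ (pow_ne_zero _ l.coe_ne_zero), one_mul]
  rw [map_tsum_mul_tsum hτ hττ hτm hx']
  simp only [hcorr, hτs, star_pow, hl, pow_zero, one_smul]

/-- Spectral factorization near the identity: if `V(s) = 1 + ∑_{k ≥ 1} vₖ sᵏ` is close to `1`, then
`τ(V(l⁻¹)) V(l⁻¹) = τ(P(l)) P(l)` on the unit circle for a power series `P` close to `1`.
The two sides are expanded at inverse points, so that a loop holomorphic outside the disc is traded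
for a loop holomorphic inside. -/
theorem exists_spectral_factorization {τ : A →+ A} (hτ : ∀ a, ‖τ a‖ = ‖a‖)
    (hττ : ∀ a, τ (τ a) = a) (hτm : ∀ a b, τ (a * b) = τ b * τ a)
    (hτs : ∀ (c : ℂ) a, τ (c • a) = star c • τ a) {κ : A →+* A} (hκ : Continuous κ)
    (hκτ : ∀ a, κ (τ a) = τ (κ a)) (hκs : ∀ (c : ℂ) a, κ (c • a) = c • κ a)
    {v : ℕ → A} (hv0 : v 0 = 1) (hv : ∀ k, k ≠ 0 → ‖v k‖ ≤ 1 / 32 / 2 ^ k)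
    (hκv : ∀ n, κ (v n) = (-1) ^ n * v n) :
    ∃ p : ℕ → A, (∀ n, ‖p n - if n = 0 then 1 else 0‖ ≤ 1 / 8 / 2 ^ n) ∧
      (∀ n, κ (p n) = (-1) ^ n * p n) ∧ τ (p 0) = p 0 ∧
      ∀ l : Circle, τ (∑' k, (l : ℂ) ^ k • p k) * ∑' k, (l : ℂ) ^ k • p k =
        τ (∑' k, (l : ℂ)⁻¹ ^ k • v k) * ∑' k, (l : ℂ)⁻¹ ^ k • v k := by
  have hτ1 : τ 1 = 1 := by
    have h := hτm (τ 1) 1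
    rwa [mul_one, hττ, mul_one, eq_comm] at h
  have hτc : Continuous τ := (AddMonoidHomClass.isometry_of_norm τ hτ).continuous
  let δ : ℕ → A := fun n => if n = 0 then 1 else 0
  -- Correlation of a perturbation of the unit series `δ`.
  have hδ : ∀ (y : ℕ → A) (b : ℝ), (∀ k, ‖y k‖ ≤ b / 2 ^ k) → ∀ n,
      correlation τ (fun k => δ k + y k) (fun k => δ k + y k) n =
        δ n + y n + (if n = 0 then τ (y 0) else 0) + correlation τ y y n := by
    intro y b hy n
    have hs := summable_correlation hτ hy hy n
    have hterm : ∀ k, τ (δ k + y k) * (δ (n + k) + y (n + k)) =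
        (if k = 0 then δ n + y n + (if n = 0 then τ (y 0) else 0) else 0) +
          τ (y k) * y (n + k) := by
      intro k
      rcases Nat.eq_zero_or_pos k with rfl | hk
      · by_cases hn : n = 0
        · subst hn; simp [δ, hτ1]; noncomm_ring
        · simp [δ, hτ1, hn]; noncomm_ring
      · simp [δ, hk.ne']
    unfold correlation
    simp only [hterm]
    rw [Summable.tsum_add (hasSum_ite_eq 0 _).summable hs, tsum_ite_eq]
  -- Boundedness of the coefficients is all that the sums below require.
  have hbd : ∀ (y : ℕ → A) (b : ℝ), 0 ≤ b → (∀ k, ‖y k‖ ≤ b / 2 ^ k) →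
      ∀ k, ‖δ k + y k‖ ≤ (‖(1 : A)‖ + b) / 2 ^ k := by
    intro y b hb hy k
    rcases Nat.eq_zero_or_pos k with rfl | hk
    · simpa [δ] using (norm_add_le _ _).trans (add_le_add_right (hy 0) _)
    · simp only [δ, hk.ne', if_false, zero_add]
      exact (hy k).trans (by gcongr; linarith [norm_nonneg (1 : A)])
  let u : ℕ → A := fun n => if n = 0 then 0 else v n
  have hvu : v = fun k => δ k + u k := by
    ext k; by_cases hk : k = 0 <;> simp [δ, u, hk, hv0]
  have hu : ∀ k, ‖u k‖ ≤ 1 / 32 / 2 ^ k := fun k => by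
    by_cases hk : k = 0
    · simp [u, hk]
    · simpa [u, hk] using hv k hk
  have hκu : ∀ n, κ (u n) = (-1) ^ n * u n := fun n => by
    by_cases hn : n = 0
    · simp [u, hn]
    · simpa [u, hn] using hκv n
  have hκδ : ∀ n, κ (δ n) = (-1) ^ n * δ n := fun n => by
    by_cases hn : n = 0 <;> simp [δ, hn]
  have hvbd : ∀ k, ‖v k‖ ≤ (‖(1 : A)‖ + 1 / 32) / 2 ^ k := fun k => by
    rw [hvu]; exact hbd u _ (by norm_num) hu k
  let W : ℕ → A := correlation τ u u
  have hu0 : u 0 = 0 := by simp [u]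
  have hW : ∀ n, correlation τ v v n = δ n + u n + W n := by
    intro n; rw [hvu, hδ u _ hu]; simp [hu0, W]
  let E : ℕ → A := fun n => τ (u n + W n)
  have hE : ∀ n, ‖E n‖ ≤ 1 / 16 / 2 ^ n := fun n => by
    simp only [E]
    rw [hτ]
    refine (norm_add_le _ _).trans ((add_le_add (hu n) (norm_correlation_le hτ hu hu n)).trans ?_)
    rw [← add_div]; gcongr; norm_num
  have hτneg : ∀ n (y : A), τ ((-1) ^ n * y) = (-1) ^ n * τ y := fun n y => by
    rcases neg_one_pow_eq_or A n with h | h <;> simp [h]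
  have hκE : ∀ n, κ (E n) = (-1) ^ n * E n := fun n => by
    simp only [E, W]
    rw [hκτ, map_add, hκu, map_correlation hτ hκ hκτ hu hu hκu hκu, ← mul_add, hτneg]
  obtain ⟨x, hx, hκx, hfix⟩ := exists_correlation_fixedPoint hτ hκ hκτ hκs hE hκE
  have hself : ∀ (y : ℕ → A) (b : ℝ), (∀ k, ‖y k‖ ≤ b / 2 ^ k) →
      τ (correlation τ y y 0) = correlation τ y y 0 := fun y b hy => by
    unfold correlation
    rw [(summable_correlation hτ hy hy 0).map_tsum τ hτc]
    simp [hτm, hττ]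
  have hx0 : τ (x 0) = x 0 := by
    have hE0 : τ (E 0) = E 0 := by simp only [E, W, hu0, zero_add, hself u _ hu]
    have h := hfix 0
    rw [h, hτs, map_sub, hself x _ hx, hE0]
    simp
  -- The correlations of `P` are the conjugates of those of `V`.
  have hcorr : ∀ n, correlation τ (fun k => δ k + x k) (fun k => δ k + x k) n =
      τ (correlation τ v v n) := by
    intro n
    have hτδ : τ (δ n) = δ n := by by_cases hn : n = 0 <;> simp [δ, hn, hτ1]
    rw [hδ x _ hx, hW, add_assoc (δ n) (u n), map_add, hτδ]
    have h := hfix n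
    by_cases hn : n = 0
    · subst hn
      have h2 : x 0 + x 0 = E 0 - correlation τ x x 0 := by
        rw [← two_smul ℂ (x 0)]; nth_rewrite 1 [h]; simp [smul_smul]
      simp only [if_true, hx0]
      rw [add_assoc (δ 0), h2]; simp only [E, map_add]; abel
    · simp only [hn, if_false, one_smul] at h ⊢
      rw [add_zero, add_assoc, eq_sub_iff_add_eq.1 h]
  refine ⟨fun k => δ k + x k, fun n => by simpa [δ] using hx n, fun n => ?_, ?_, fun l => ?_⟩
  · rw [map_add, hκδ, hκx, mul_add]
  · simp [δ, hτ1, hx0]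
  · rw [map_tsum_mul_tsum_circle hτ hττ hτm hτs (hbd x _ (by norm_num) hx) l]
    have hv' := map_tsum_mul_tsum_circle hτ hττ hτm hτs hvbd l⁻¹
    rw [Circle.coe_inv, inv_inv] at hv'
    rw [hv']
    simp only [hcorr, hττ, hself v _ hvbd]
    congr 2; ext n; rw [add_comm]

end Factorization

/-! ### The indefinite factorization of matrix loops near the identity -/

section Matrices

open Metric

open scoped Matrix.Norms.Frobenius

lemma J_mul_J : J * J = 1 := by
  ext i j; fin_cases i <;> fin_cases j <;> simp [J]

lemma conjTranspose_J : Jᴴ = J := by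
  ext i j; fin_cases i <;> fin_cases j <;> simp [J]

lemma sigma_apply (X : Matrix (Fin 2) (Fin 2) ℂ) (i j : Fin 2) :
    sigma X i j = (if i = j then 1 else -1) * X i j := by
  simp only [sigma, Matrix.mul_apply, Fin.sum_univ_two]
  fin_cases i <;> fin_cases j <;> simp [J]

lemma norm_sigma (X : Matrix (Fin 2) (Fin 2) ℂ) : ‖sigma X‖ = ‖X‖ := by
  simp only [Matrix.frobenius_norm_def, sigma_apply]
  congr 2; ext i; congr 1; ext j
  split_ifs <;> simp

lemma norm_apply_le_frobenius (X : Matrix (Fin 2) (Fin 2) ℂ) (i j : Fin 2) : ‖X i j‖ ≤ ‖X‖ := by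
  rw [Matrix.frobenius_norm_def, ← Real.sqrt_eq_rpow]
  refine Real.le_sqrt_of_sq_le ?_
  simp only [Real.rpow_two]
  exact (Finset.single_le_sum (f := fun j => ‖X i j‖ ^ 2) (fun _ _ => by positivity)
    (Finset.mem_univ j)).trans (Finset.single_le_sum (f := fun i => ∑ j, ‖X i j‖ ^ 2)
      (fun _ _ => by positivity) (Finset.mem_univ i))

lemma frobenius_norm_le_of_forall {X : Matrix (Fin 2) (Fin 2) ℂ} {b : ℝ}
    (h : ∀ i j, ‖X i j‖ ≤ b) : ‖X‖ ≤ 2 * b := by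
  have hb : 0 ≤ b := (norm_nonneg _).trans (h 0 0)
  rw [Matrix.frobenius_norm_def, ← Real.sqrt_eq_rpow]
  refine Real.sqrt_le_iff.2 ⟨by positivity, ?_⟩
  simp only [Real.rpow_two, Fin.sum_univ_two]
  have h' : ∀ i j, ‖X i j‖ ^ 2 ≤ b ^ 2 := fun i j => by gcongr; exact h i j
  linarith [h' 0 0, h' 0 1, h' 1 0, h' 1 1]

/-- The involution `σ` as an automorphism of `M₂(ℂ)`. -/
noncomputable def sigmaHom : Matrix (Fin 2) (Fin 2) ℂ →+* Matrix (Fin 2) (Fin 2) ℂ where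
  toFun := sigma
  map_one' := by simp [sigma, J_mul_J]
  map_mul' X Y := by
    have : J * X * J * (J * Y * J) = J * X * (J * J) * Y * J := by noncomm_ring
    simp only [sigma, this, J_mul_J]; noncomm_ring
  map_zero' := by simp [sigma]
  map_add' X Y := by simp only [sigma]; noncomm_ring

/-- The adjoint `X ↦ J Xᴴ J` with respect to the Hermitian form `J`. -/
noncomputable def adjointJ : Matrix (Fin 2) (Fin 2) ℂ →+ Matrix (Fin 2) (Fin 2) ℂ where
  toFun X := sigma Xᴴ
  map_zero' := by simp [sigma]
  map_add' X Y := by simp only [sigma, Matrix.conjTranspose_add]; noncomm_ring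

lemma adjointJ_apply (X : Matrix (Fin 2) (Fin 2) ℂ) : adjointJ X = J * Xᴴ * J := rfl

lemma sigmaHom_apply (X : Matrix (Fin 2) (Fin 2) ℂ) : sigmaHom X = sigma X := rfl

lemma norm_adjointJ (X : Matrix (Fin 2) (Fin 2) ℂ) : ‖adjointJ X‖ = ‖X‖ :=
  (norm_sigma _).trans (Matrix.frobenius_norm_conjTranspose X)

lemma adjointJ_adjointJ (X : Matrix (Fin 2) (Fin 2) ℂ) : adjointJ (adjointJ X) = X := by
  have : J * (J * (X * J)) * J = (J * J) * X * (J * J) := by noncomm_ring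
  simp [adjointJ_apply, conjTranspose_J, this, J_mul_J]

lemma adjointJ_mul (X Y : Matrix (Fin 2) (Fin 2) ℂ) :
    adjointJ (X * Y) = adjointJ Y * adjointJ X := by
  have : J * Yᴴ * J * (J * Xᴴ * J) = J * Yᴴ * (J * J) * Xᴴ * J := by noncomm_ring
  simp only [adjointJ_apply, this, J_mul_J, Matrix.conjTranspose_mul]; noncomm_ring

lemma adjointJ_smul (c : ℂ) (X : Matrix (Fin 2) (Fin 2) ℂ) :
    adjointJ (c • X) = star c • adjointJ X := by
  simp [adjointJ_apply, Matrix.conjTranspose_smul]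

lemma sigma_smul (c : ℂ) (X : Matrix (Fin 2) (Fin 2) ℂ) : sigma (c • X) = c • sigma X := by
  simp [sigma]

lemma sigma_adjointJ (X : Matrix (Fin 2) (Fin 2) ℂ) :
    sigma (adjointJ X) = adjointJ (sigma X) := by
  simp [sigma, adjointJ_apply, Matrix.conjTranspose_mul, conjTranspose_J, mul_assoc]

lemma continuous_sigmaHom : Continuous sigmaHom :=
  (AddMonoidHomClass.isometry_of_norm sigmaHom norm_sigma).continuous

/-- Taylor coefficients of a `σ`-twisted matrix function close to `1` on the circle of radius `2`,
with the Cauchy estimates. -/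
lemma exists_twisted_taylor {N : ℂ → Matrix (Fin 2) (Fin 2) ℂ} {η : ℝ}
    (hd : ∀ i j, DifferentiableOn ℂ (fun s => N s i j) (ball 0 3))
    (h0 : N 0 = 1) (hσ : ∀ s, N (-s) = sigma (N s))
    (hη : ∀ s ∈ sphere (0 : ℂ) 2, ∀ i j, ‖(N s - 1) i j‖ ≤ η) :
    ∃ v : ℕ → Matrix (Fin 2) (Fin 2) ℂ, v 0 = 1 ∧ (∀ k, k ≠ 0 → ‖v k‖ ≤ 2 * η / 2 ^ k) ∧
      (∀ k, sigma (v k) = (-1) ^ k * v k) ∧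
      ∀ s ∈ ball (0 : ℂ) 3, HasSum (fun k => s ^ k • v k) (N s) := by
  let m : Fin 2 → Fin 2 → ℂ → ℂ := fun i j s => (N s - 1) i j
  have hm : ∀ i j, DifferentiableOn ℂ (m i j) (ball 0 3) := fun i j =>
    (hd i j).sub_const _
  let v : ℕ → Matrix (Fin 2) (Fin 2) ℂ := fun k => (if k = 0 then 1 else 0) +
    Matrix.of fun i j => (k.factorial : ℂ)⁻¹ * iteratedDeriv k (m i j) 0
  have hv0 : v 0 = 1 := by
    ext i j; simp [v, m, h0]
  refine ⟨v, hv0, fun k hk => ?_, fun k => ?_, fun s hs => ?_⟩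
  · rw [mul_div_assoc]
    refine frobenius_norm_le_of_forall fun i j => ?_
    have hc : DiffContOnCl ℂ (m i j) (ball 0 2) :=
      ((hm i j).mono (closedBall_subset_ball (by norm_num))).diffContOnCl_ball subset_rfl
    have h := Complex.norm_iteratedDeriv_le_of_forall_mem_sphere_norm_le k two_pos hc
      (fun s hs => hη s hs i j)
    have hf : (0 : ℝ) < k.factorial := by positivity
    simp only [v, hk, if_false, zero_add, Matrix.of_apply, norm_mul, norm_inv,
      Complex.norm_natCast]
    calc _ ≤ (k.factorial : ℝ)⁻¹ * (k.factorial * η / 2 ^ k) := by gcongr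
      _ = η / 2 ^ k := by field_simp
  · ext i j
    have hpar : (fun s => m i j (-s)) = fun s => (if i = j then (1 : ℂ) else -1) * m i j s := by
      ext s
      simp only [m, hσ, Matrix.sub_apply, sigma_apply]
      by_cases hij : i = j <;> simp [hij]
    have h1 : (if i = j then (1 : ℂ) else -1) * iteratedDeriv k (m i j) 0 =
        (-1) ^ k * iteratedDeriv k (m i j) 0 := by
      rw [← iteratedDeriv_const_mul_field, ← hpar, iteratedDeriv_comp_neg]
      simp
    have hpow : ((-1) ^ k * v k) i j = (-1) ^ k * v k i j := by
      rcases Nat.even_or_odd k with hk | hk <;> simp [hk.neg_one_pow]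
    rw [sigma_apply, hpow]
    by_cases hk : k = 0
    · subst hk; rw [hv0]; by_cases hij : i = j <;> simp [hij]
    · simp only [v, hk, if_false, zero_add, Matrix.of_apply]
      linear_combination (k.factorial : ℂ)⁻¹ * h1
  · refine Pi.hasSum.2 fun i => Pi.hasSum.2 fun j => ?_
    have h := Complex.hasSum_taylorSeries_on_ball (hm i j) hs
    have h2 := (hasSum_ite_eq (0 : ℕ) ((1 : Matrix (Fin 2) (Fin 2) ℂ) i j)).add h
    convert h2 using 1
    · ext k
      by_cases hk : k = 0
      · subst hk; simp [v]
      · simp [v, hk]; ring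
    · simp [m]

lemma det_sub_one_norm_lt {X : Matrix (Fin 2) (Fin 2) ℂ} (h : ∀ i j, ‖(X - 1) i j‖ ≤ 1 / 4) :
    ‖X.det - 1‖ < 1 := by
  have e : X.det - 1 = (X - 1) 0 0 + (X - 1) 1 1 + (X - 1) 0 0 * (X - 1) 1 1 -
      (X - 1) 0 1 * (X - 1) 1 0 := by
    simp [Matrix.det_fin_two]; ring
  have hm : ∀ a b c d : Fin 2, ‖(X - 1) a b * (X - 1) c d‖ ≤ 1 / 4 * (1 / 4) := fun a b c d => by
    rw [norm_mul]; gcongr <;> exact h _ _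
  rw [e]
  calc _ ≤ ‖(X - 1) 0 0‖ + ‖(X - 1) 1 1‖ + ‖(X - 1) 0 0 * (X - 1) 1 1‖ +
      ‖(X - 1) 0 1 * (X - 1) 1 0‖ :=
        (norm_sub_le _ _).trans (by gcongr; exact norm_add₃_le)
    _ < 1 := by linarith [h 0 0, h 1 1, hm 0 0 1 1, hm 0 1 1 0]

/-- A zero-free holomorphic function on the disc of modulus one on the circle is constant. -/
lemma eq_of_norm_eq_one_on_circle {f : ℂ → ℂ} (hf : DiffContOnCl ℂ f (ball 0 1))
    (hne : ∀ s ∈ closedBall (0 : ℂ) 1, f s ≠ 0) (h1 : ∀ l : Circle, ‖f l‖ = 1) :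
    ‖f 0‖ = 1 ∧ ∀ s ∈ closedBall (0 : ℂ) 1, f s = f 0 := by
  have hcl : closure (ball (0 : ℂ) 1) = closedBall 0 1 := closure_ball _ one_ne_zero
  have hfr : ∀ s ∈ frontier (ball (0 : ℂ) 1), ‖f s‖ = 1 := fun s hs => by
    rw [frontier_ball _ one_ne_zero] at hs
    exact h1 ⟨s, by simpa [Submonoid.unitSphere] using hs⟩
  have hle : ∀ s ∈ closedBall (0 : ℂ) 1, ‖f s‖ ≤ 1 := fun s hs =>
    Complex.norm_le_of_forall_mem_frontier_norm_le isBounded_ball hf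
      (fun z hz => (hfr z hz).le) (hcl ▸ hs)
  have hge : ∀ s ∈ closedBall (0 : ℂ) 1, ‖(f s)⁻¹‖ ≤ 1 := fun s hs =>
    Complex.norm_le_of_forall_mem_frontier_norm_le (f := f⁻¹) isBounded_ball
      (hf.inv fun z hz => hne z (hcl ▸ hz))
      (fun z hz => by simp [hfr z hz]) (hcl ▸ hs)
  have hone : ∀ s ∈ closedBall (0 : ℂ) 1, ‖f s‖ = 1 := fun s hs => by
    refine le_antisymm (hle s hs) ?_
    have := hge s hs
    rw [norm_inv] at this
    exact (inv_le_one₀ (norm_pos_iff.2 (hne s hs))).1 this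
  have h0 := hone 0 (by simp)
  refine ⟨h0, Complex.eqOn_closedBall_of_isMaxOn_norm hf fun s hs => ?_⟩
  change ‖f s‖ ≤ ‖f 0‖
  rw [h0]; exact hle s (ball_subset_closedBall hs)

/-- Existence of the plus factor: a unimodular `σ`-twisted function `N` on a disc, close to `1`,
admits `P` with `P(l)ᴴ J P(l) = N(l⁻¹)ᴴ J N(l⁻¹)` on the unit circle, where `P` is holomorphic,
unimodular and twisted on the disc. -/
theorem exists_plus_factor {N : ℂ → Matrix (Fin 2) (Fin 2) ℂ}
    (hd : ∀ i j, DifferentiableOn ℂ (fun s => N s i j) (ball 0 3))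
    (h0 : N 0 = 1) (hσ : ∀ s, N (-s) = sigma (N s))
    (hη : ∀ s ∈ sphere (0 : ℂ) 2, ∀ i j, ‖(N s - 1) i j‖ ≤ 1 / 64)
    (hdet : ∀ l : Circle, (N (l : ℂ)⁻¹).det = 1) :
    ∃ P : ℂ → Matrix (Fin 2) (Fin 2) ℂ,
      (∀ i j, DifferentiableOn ℂ (fun s => P s i j) (ball 0 (3 / 2))) ∧
      (∀ s ∈ ball (0 : ℂ) (3 / 2), P (-s) = sigma (P s)) ∧
      (∀ s ∈ closedBall (0 : ℂ) 1, (P s).det = 1) ∧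
      (∃ ρ : ℝ, 0 < ρ ∧ P 0 = !![(ρ : ℂ), 0; 0, (ρ : ℂ)⁻¹]) ∧
      ∀ l : Circle, (P l)ᴴ * J * P l = (N (l : ℂ)⁻¹)ᴴ * J * N (l : ℂ)⁻¹ := by
  obtain ⟨v, hv0, hv, hκv, hvs⟩ := exists_twisted_taylor hd h0 hσ hη
  obtain ⟨p, hp, hκp, hp0, hfac⟩ := exists_spectral_factorization norm_adjointJ adjointJ_adjointJ
    adjointJ_mul adjointJ_smul continuous_sigmaHom sigma_adjointJ sigma_smul hv0
    (fun k hk => (hv k hk).trans (by gcongr; norm_num)) hκv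
  let P : ℂ → Matrix (Fin 2) (Fin 2) ℂ := fun s => ∑' k, s ^ k • p k
  have hpb : ∀ k, ‖p k‖ ≤ (‖(1 : Matrix (Fin 2) (Fin 2) ℂ)‖ + 1 / 8) / 2 ^ k := fun k => by
    have h := hp k
    by_cases hk : k = 0
    · subst hk
      simp only [if_true, pow_zero, div_one] at h ⊢
      calc ‖p 0‖ = ‖1 + (p 0 - 1)‖ := by simp
        _ ≤ _ := (norm_add_le _ _).trans (by gcongr)
    · simp only [hk, if_false, sub_zero] at h
      exact h.trans (by gcongr; simp)
  set C : ℝ := ‖(1 : Matrix (Fin 2) (Fin 2) ℂ)‖ + 1 / 8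
  have hC : 0 ≤ C := by positivity
  have hterm : ∀ k, ∀ s ∈ ball (0 : ℂ) (3 / 2), ‖s ^ k • p k‖ ≤ C * (3 / 4) ^ k := fun k s hs => by
    rw [mem_ball_zero_iff] at hs
    calc ‖s ^ k • p k‖ = ‖s‖ ^ k * ‖p k‖ := by rw [norm_smul, norm_pow]
      _ ≤ (3 / 2) ^ k * (C / 2 ^ k) := by gcongr; exact hpb k
      _ = C * (3 / 4) ^ k := by
        rw [mul_div_left_comm, ← div_pow]; norm_num
  have hgeo : Summable fun k : ℕ => C * (3 / 4 : ℝ) ^ k :=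
    (summable_geometric_of_lt_one (by norm_num) (by norm_num)).mul_left C
  have hsum : ∀ s ∈ ball (0 : ℂ) (3 / 2), Summable fun k => s ^ k • p k := fun s hs =>
    Summable.of_norm_bounded hgeo fun k => hterm k s hs
  have hPd : DifferentiableOn ℂ P (ball 0 (3 / 2)) :=
    Complex.differentiableOn_tsum_of_summable_norm hgeo
      (fun k => ((differentiable_id.pow k).smul_const (p k)).differentiableOn) isOpen_ball hterm
  have hPij : ∀ i j, DifferentiableOn ℂ (fun s => P s i j) (ball 0 (3 / 2)) := fun i j =>
    (LinearMap.toContinuousLinearMap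
      (Matrix.entryLinearMap ℂ ℂ i j)).differentiable.comp_differentiableOn hPd
  have hsub : closedBall (0 : ℂ) 1 ⊆ ball 0 (3 / 2) := closedBall_subset_ball (by norm_num)
  have hP1 : ∀ s ∈ closedBall (0 : ℂ) 1, ∀ i j, ‖(P s - 1) i j‖ ≤ 1 / 4 := fun s hs i j => by
    refine (norm_apply_le_frobenius _ i j).trans ?_
    have h := (hsum s (hsub hs)).hasSum.sub
      (hasSum_ite_eq (0 : ℕ) (1 : Matrix (Fin 2) (Fin 2) ℂ))
    change ‖∑' k, s ^ k • p k - 1‖ ≤ 1 / 4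
    rw [← h.tsum_eq]
    have hg : HasSum (fun k : ℕ => 1 / 8 / 2 ^ k) (1 / 4 : ℝ) := by
      have h2 := hasSum_geometric_two.mul_left (1 / 8 : ℝ)
      have e : (fun k : ℕ => 1 / 8 * (1 / 2 : ℝ) ^ k) = fun k => 1 / 8 / 2 ^ k := by
        ext k; rw [one_div_pow, mul_one_div]
      rwa [e, show (1 / 8 * 2 : ℝ) = 1 / 4 by norm_num] at h2
    refine tsum_of_norm_bounded hg fun k => ?_
    have hs1 : ‖s‖ ^ k ≤ 1 := pow_le_one₀ (norm_nonneg _) (by simpa using hs)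
    have e : s ^ k • p k - (if k = 0 then 1 else 0) =
        s ^ k • (p k - if k = 0 then 1 else 0) := by
      by_cases hk : k = 0 <;> simp [hk]
    rw [e, norm_smul, norm_pow]
    exact (mul_le_of_le_one_left (norm_nonneg _) hs1).trans (hp k)
  have hP0 : P 0 = p 0 := by
    change ∑' k, (0 : ℂ) ^ k • p k = p 0
    rw [tsum_eq_single 0 fun k hk => by simp [hk]]; simp
  have hform : ∀ l : Circle, (P l)ᴴ * J * P l = (N (l : ℂ)⁻¹)ᴴ * J * N (l : ℂ)⁻¹ := fun l => by
    have hl3 : (l : ℂ)⁻¹ ∈ ball (0 : ℂ) 3 := by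
      rw [mem_ball_zero_iff, norm_inv, Circle.norm_coe]; norm_num
    have h := congrArg (J * ·) (hfac l)
    -- The topologies on matrices in the two sums agree only up to unfolding of the Frobenius norm.
    erw [(hvs _ hl3).tsum_eq] at h
    change J * (J * (P l)ᴴ * J * P l) = J * (J * (N (l : ℂ)⁻¹)ᴴ * J * N (l : ℂ)⁻¹) at h
    simpa only [← mul_assoc, J_mul_J, one_mul] using h
  have hdetc : DiffContOnCl ℂ (fun s => (P s).det) (ball 0 1) := by
    have h : DifferentiableOn ℂ (fun s => (P s).det) (ball 0 (3 / 2)) := by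
      simp only [Matrix.det_fin_two]
      exact ((hPij 0 0).mul (hPij 1 1)).sub ((hPij 0 1).mul (hPij 1 0))
    exact (h.mono hsub).diffContOnCl_ball subset_rfl
  have hdetne : ∀ s ∈ closedBall (0 : ℂ) 1, (P s).det ≠ 0 := fun s hs h => by
    have := det_sub_one_norm_lt (hP1 s hs)
    simp [h] at this
  have hdet1 : ∀ l : Circle, ‖(P l).det‖ = 1 := fun l => by
    have h := congrArg Matrix.det (hform l)
    have hJ : J.det ≠ 0 := by simp [J, Matrix.det_fin_two]
    rw [Matrix.det_mul, Matrix.det_mul, Matrix.det_mul, Matrix.det_mul, hdet,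
      Matrix.det_conjTranspose, Matrix.det_conjTranspose, hdet, star_one, one_mul, mul_one,
      mul_right_comm] at h
    have h' : star (P l).det * (P l).det = 1 := mul_right_cancel₀ hJ (by rw [h, one_mul])
    have h2 := congrArg norm h'
    rw [norm_mul, norm_star, norm_one] at h2
    nlinarith [norm_nonneg (P l).det]
  obtain ⟨hn0, hconst⟩ := eq_of_norm_eq_one_on_circle hdetc hdetne hdet1
  -- At the centre `P` is diagonal by the twisting and real by self-adjointness.
  have hdiag : ∀ i j, i ≠ j → p 0 i j = 0 := fun i j hij => by
    have h := congrFun (congrFun (hκp 0) i) j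
    rw [sigmaHom_apply, sigma_apply] at h
    simp only [hij, if_false, pow_zero, one_mul] at h
    linear_combination (-1 / 2 : ℂ) * h
  have hreal : ∀ i, ((p 0 i i).re : ℂ) = p 0 i i := fun i => by
    have h := congrFun (congrFun hp0 i) i
    rw [adjointJ_apply] at h
    change sigma _ i i = _ at h
    rw [sigma_apply] at h
    simp only [if_true, one_mul, Matrix.conjTranspose_apply] at h
    exact Complex.conj_eq_iff_re.1 h
  have hpos : ∀ i, 0 < (p 0 i i).re := fun i => by
    have h := (Complex.abs_re_le_norm _).trans (hP1 0 (by simp) i i)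
    rw [hP0, Matrix.sub_apply, Matrix.one_apply_eq, Complex.sub_re, Complex.one_re] at h
    linarith [(abs_le.1 h).1]
  have hd0 : (P 0).det = (((p 0 0 0).re * (p 0 1 1).re : ℝ) : ℂ) := by
    rw [hP0, Matrix.det_fin_two, hdiag 0 1 (by simp), zero_mul, sub_zero, Complex.ofReal_mul,
      hreal, hreal]
  have hprod : (p 0 0 0).re * (p 0 1 1).re = 1 := by
    have h : ‖(P 0).det‖ = 1 := hn0
    rw [hd0, Complex.norm_real, Real.norm_eq_abs,
      abs_of_pos (mul_pos (hpos 0) (hpos 1))] at h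
    exact h
  refine ⟨P, hPij, fun s hs => ?_, fun s hs => ?_, ⟨(p 0 0 0).re, hpos 0, ?_⟩, hform⟩
  · change ∑' k, (-s) ^ k • p k = sigmaHom (∑' k, s ^ k • p k)
    rw [(hsum s hs).map_tsum sigmaHom continuous_sigmaHom]
    congr 1; ext1 k
    rw [sigmaHom_apply, sigma_smul, ← sigmaHom_apply, hκp, neg_pow, mul_comm, mul_smul]
    congr 1
    rcases Nat.even_or_odd k with hk | hk <;> simp [hk.neg_one_pow]
  · have h : (P s).det = (P 0).det := hconst s hs
    rw [h, hd0, hprod, Complex.ofReal_one]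
  · have h11 : p 0 1 1 = (((p 0 0 0).re : ℝ) : ℂ)⁻¹ := by
      rw [← hreal 1, eq_inv_of_mul_eq_one_right hprod, Complex.ofReal_inv]
    rw [hP0, hreal, ← hreal 0, ← h11]
    ext i j
    fin_cases i <;> fin_cases j
    · exact (hreal 0).symm
    · exact hdiag 0 1 (by simp)
    · exact hdiag 1 0 (by simp)
    · rfl

end Matrices

/-! ### The two Bessel-type series and their Wronskian -/

section Bessel

open Metric

/-- The coefficient `1 / (16ʲ (j!)²)`. -/
noncomputable def besselCoeff (j : ℕ) : ℂ := 1 / (16 ^ j * (j.factorial : ℂ) ^ 2)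

/-- The series `∑ tʲ / (16ʲ (j!)²)`, so that `y₀(z, l) = besselF (l⁻² z⁴)`. -/
noncomputable def besselF (t : ℂ) : ℂ := ∑' j, besselCoeff j * t ^ j

/-- The series `∑ (1 + ⋯ + 1/j) tʲ / (16ʲ (j!)²)`, so that `y₁(z, l) = -2 l⁻¹ besselG (l⁻² z⁴)`. -/
noncomputable def besselG (t : ℂ) : ℂ := ∑' j, ((harmonic j : ℚ) : ℂ) * besselCoeff j * t ^ j

lemma harmonic_nonneg_le (j : ℕ) : 0 ≤ harmonic j ∧ harmonic j ≤ j := by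
  induction j with
  | zero => simp
  | succ n ih =>
    rw [harmonic_succ]
    have h1 : ((n + 1 : ℕ) : ℚ)⁻¹ ≤ 1 := inv_le_one_of_one_le₀ (by simp)
    have h0 : 0 ≤ ((n + 1 : ℕ) : ℚ)⁻¹ := by positivity
    push_cast at *
    constructor <;> linarith [ih.1, ih.2]

lemma norm_harmonic_le (j : ℕ) : ‖((harmonic j : ℚ) : ℂ)‖ ≤ j := by
  obtain ⟨h0, h1⟩ := harmonic_nonneg_le j
  rw [Complex.norm_ratCast, abs_of_nonneg (by exact_mod_cast h0)]
  exact_mod_cast h1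

/-- A factor of size at most `j²` does not spoil the geometric decay, since `j ≤ j!`. -/
lemma norm_mul_besselCoeff_le {c : ℂ} {j : ℕ} (hc : ‖c‖ ≤ (j.factorial : ℝ) ^ 2) :
    ‖c * besselCoeff j‖ ≤ (1 / 16) ^ j := by
  have hf : (0 : ℝ) < (j.factorial : ℝ) ^ 2 := by positivity
  have e : ‖besselCoeff j‖ = (1 / 16) ^ j / (j.factorial : ℝ) ^ 2 := by
    simp [besselCoeff, div_eq_mul_inv, mul_comm]
  rw [norm_mul, e, mul_div_assoc', div_le_iff₀ hf, mul_comm]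
  gcongr

lemma one_le_factorial_real (j : ℕ) : (1 : ℝ) ≤ j.factorial := by
  exact_mod_cast j.factorial_pos

lemma natCast_le_factorial (j : ℕ) : (j : ℝ) ≤ j.factorial := by
  exact_mod_cast j.self_le_factorial

section PowerSeries

variable {c : ℕ → ℂ} (hc : ∀ j, ‖c j‖ ≤ (1 / 16) ^ j)
include hc

lemma norm_powerSeries_term_le (j : ℕ) {t : ℂ} (ht : t ∈ ball (0 : ℂ) 1) :
    ‖c j * t ^ j‖ ≤ (1 / 16) ^ j := by
  rw [norm_mul, norm_pow]
  rw [mem_ball_zero_iff] at ht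
  exact (mul_le_of_le_one_right (norm_nonneg _) (pow_le_one₀ (norm_nonneg _) ht.le)).trans (hc j)

lemma summable_powerSeries {t : ℂ} (ht : t ∈ ball (0 : ℂ) 1) : Summable fun j => c j * t ^ j :=
  Summable.of_norm_bounded (summable_geometric_of_lt_one (by norm_num) (by norm_num))
    fun j => norm_powerSeries_term_le hc j ht

lemma differentiableOn_powerSeries :
    DifferentiableOn ℂ (fun t => ∑' j, c j * t ^ j) (ball 0 1) :=
  Complex.differentiableOn_tsum_of_summable_norm
    (summable_geometric_of_lt_one (r := 1 / 16) (by norm_num) (by norm_num))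
    (fun j => by fun_prop) isOpen_ball fun j _ ht => norm_powerSeries_term_le hc j ht

/-- The Euler operator `t d/dt` acts on a power series by multiplying the coefficients by `j`. -/
lemma hasSum_euler_powerSeries {t : ℂ} (ht : t ∈ ball (0 : ℂ) 1) :
    HasSum (fun j : ℕ => j * c j * t ^ j) (t * deriv (fun t => ∑' j, c j * t ^ j) t) := by
  have h := (Complex.hasSum_deriv_of_summable_norm
    (summable_geometric_of_lt_one (r := 1 / 16) (by norm_num) (by norm_num))
    (fun j => by fun_prop) isOpen_ball (fun j _ hw => norm_powerSeries_term_le hc j hw)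
    ht).mul_left t
  refine h.congr_fun fun j => ?_
  rw [deriv_const_mul_field, deriv_pow_field]
  cases j with
  | zero => simp
  | succ n => simp only [Nat.add_sub_cancel]; ring

end PowerSeries

lemma norm_coeffF_le (j : ℕ) : ‖besselCoeff j‖ ≤ (1 / 16) ^ j := by
  simpa using norm_mul_besselCoeff_le (c := 1) (j := j)
    (by rw [norm_one]; exact one_le_pow₀ (one_le_factorial_real j))

lemma norm_coeffG_le (j : ℕ) : ‖((harmonic j : ℚ) : ℂ) * besselCoeff j‖ ≤ (1 / 16) ^ j :=
  norm_mul_besselCoeff_le ((norm_harmonic_le j).trans (by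
    nlinarith [one_le_factorial_real j, natCast_le_factorial j]))

lemma norm_coeffF1_le (j : ℕ) : ‖(j : ℂ) * besselCoeff j‖ ≤ (1 / 16) ^ j :=
  norm_mul_besselCoeff_le (by
    rw [Complex.norm_natCast]; nlinarith [one_le_factorial_real j, natCast_le_factorial j])

lemma norm_coeffG1_le (j : ℕ) :
    ‖(j : ℂ) * (((harmonic j : ℚ) : ℂ) * besselCoeff j)‖ ≤ (1 / 16) ^ j := by
  rw [← mul_assoc]
  refine norm_mul_besselCoeff_le ?_
  rw [norm_mul, Complex.norm_natCast, sq]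
  exact mul_le_mul (natCast_le_factorial j) ((norm_harmonic_le j).trans (natCast_le_factorial j))
    (norm_nonneg _) (by positivity)

lemma besselCoeff_succ (j : ℕ) :
    ((j + 1 : ℕ) : ℂ) * (((j + 1 : ℕ) : ℂ) * besselCoeff (j + 1)) = besselCoeff j / 16 := by
  have h1 : ((j : ℂ) + 1) ≠ 0 := Nat.cast_add_one_ne_zero j
  have h2 : (j.factorial : ℂ) ≠ 0 := by exact_mod_cast j.factorial_ne_zero
  simp only [besselCoeff, Nat.factorial_succ]
  push_cast
  field_simp
  ring

lemma differentiableOn_besselF : DifferentiableOn ℂ besselF (ball 0 1) :=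
  differentiableOn_powerSeries norm_coeffF_le

lemma differentiableOn_besselG : DifferentiableOn ℂ besselG (ball 0 1) :=
  differentiableOn_powerSeries norm_coeffG_le

lemma besselF_zero : besselF 0 = 1 := by
  rw [besselF, tsum_eq_single 0 fun j hj => by simp [hj]]
  simp [besselCoeff]

lemma besselG_zero : besselG 0 = 0 := by
  rw [besselG, tsum_eq_single 0 fun j hj => by simp [hj]]
  simp

/-- `θ² f = (t/16) f` for the Euler operator `θ` and `f = besselF`, with `θ f` written as a
series. -/
lemma euler_euler_besselF {t : ℂ} (ht : t ∈ ball (0 : ℂ) 1) :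
    t * deriv (fun t => ∑' j : ℕ, (j : ℂ) * besselCoeff j * t ^ j) t = t / 16 * besselF t := by
  have h := hasSum_euler_powerSeries norm_coeffF1_le ht
  rw [← h.tsum_eq, h.summable.tsum_eq_zero_add, besselF, ← tsum_mul_left]
  simp only [besselCoeff_succ]
  simp only [Nat.cast_zero, zero_mul, zero_add]
  congr 1; ext j; ring

/-- `θ² g = (t/16) g + θ f` for the Euler operator `θ`, `f = besselF` and `g = besselG`. -/
lemma euler_euler_besselG {t : ℂ} (ht : t ∈ ball (0 : ℂ) 1) :
    t * deriv (fun t => ∑' j : ℕ, (j : ℂ) * (((harmonic j : ℚ) : ℂ) * besselCoeff j) * t ^ j) t =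
      t / 16 * besselG t + ∑' j : ℕ, (j : ℂ) * besselCoeff j * t ^ j := by
  have h := hasSum_euler_powerSeries norm_coeffG1_le ht
  have hF := summable_powerSeries norm_coeffF1_le ht
  rw [← h.tsum_eq, h.summable.tsum_eq_zero_add, hF.tsum_eq_zero_add, besselG, ← tsum_mul_left]
  simp only [Nat.cast_zero, zero_mul, zero_add]
  rw [← Summable.tsum_add ((summable_powerSeries norm_coeffG_le ht).mul_left _)
    ((summable_nat_add_iff 1).2 hF)]
  congr 1; ext j
  have h1 : ((j : ℂ) + 1) ≠ 0 := Nat.cast_add_one_ne_zero j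
  have hs := besselCoeff_succ j
  have hh : ((harmonic (j + 1) : ℚ) : ℂ) = ((harmonic j : ℚ) : ℂ) + ((j : ℂ) + 1)⁻¹ := by
    rw [harmonic_succ]; push_cast; ring
  rw [hh]
  push_cast at hs ⊢
  have e : ((j : ℂ) + 1) * ((j + 1) * ((((harmonic j : ℚ) : ℂ) + ((j : ℂ) + 1)⁻¹) *
      besselCoeff (j + 1))) = ((harmonic j : ℚ) : ℂ) * ((j + 1) * ((j + 1) * besselCoeff (j + 1)))
      + (j + 1) * besselCoeff (j + 1) := by
    field_simp
  rw [e, hs]; ring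

/-- The Wronskian identity, equivalent to `det L = 1`. -/
theorem bessel_wronskian {t : ℂ} (ht : t ∈ ball (0 : ℂ) 1) :
    besselF t ^ 2 - 2 * t * (besselF t * deriv besselG t - deriv besselF t * besselG t) = 1 := by
  set f1 : ℂ → ℂ := fun t => ∑' j : ℕ, (j : ℂ) * besselCoeff j * t ^ j with hf1
  set g1 : ℂ → ℂ := fun t =>
    ∑' j : ℕ, (j : ℂ) * (((harmonic j : ℚ) : ℂ) * besselCoeff j) * t ^ j with hg1
  have eF : ∀ t ∈ ball (0 : ℂ) 1, t * deriv besselF t = f1 t := fun t ht =>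
    (hasSum_euler_powerSeries norm_coeffF_le ht).tsum_eq.symm
  have eG : ∀ t ∈ ball (0 : ℂ) 1, t * deriv besselG t = g1 t := fun t ht =>
    (hasSum_euler_powerSeries norm_coeffG_le ht).tsum_eq.symm
  have df1 : DifferentiableOn ℂ f1 (ball 0 1) := differentiableOn_powerSeries norm_coeffF1_le
  have dg1 : DifferentiableOn ℂ g1 (ball 0 1) := differentiableOn_powerSeries norm_coeffG1_le
  let W : ℂ → ℂ := fun t => besselF t ^ 2 - 2 * (besselF t * g1 t - f1 t * besselG t)
  have hW : DifferentiableOn ℂ W (ball 0 1) :=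
    (differentiableOn_besselF.pow 2).sub (((differentiableOn_besselF.mul dg1).sub
      (df1.mul differentiableOn_besselG)).const_mul 2)
  have htW : ∀ t ∈ ball (0 : ℂ) 1, t * deriv W t = 0 := fun t ht => by
    have hn := isOpen_ball.mem_nhds ht
    have a1 := (differentiableOn_besselF.differentiableAt hn).hasDerivAt
    have a2 := (differentiableOn_besselG.differentiableAt hn).hasDerivAt
    have a3 := (df1.differentiableAt hn).hasDerivAt
    have a4 := (dg1.differentiableAt hn).hasDerivAt
    have hd := ((a1.pow 2).sub (((a1.mul a4).sub (a3.mul a2)).const_mul 2)).deriv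
    change deriv W t = _ at hd
    rw [hd]
    have b1 := eF t ht
    have b2 := eG t ht
    have b3 := euler_euler_besselF ht
    have b4 := euler_euler_besselG ht
    simp only [← hf1, ← hg1] at b3 b4
    simp only [Nat.cast_ofNat, Nat.add_one_sub_one, pow_one]
    linear_combination (2 * besselF t - 2 * g1 t) * b1 + 2 * f1 t * b2
      + 2 * besselG t * b3 - 2 * besselF t * b4
  have hder : Set.EqOn (deriv W) 0 (ball 0 1) := by
    refine Set.EqOn.of_subset_closure (s := ball 0 1 ∩ {0}ᶜ) (fun t ht => ?_)
      (hW.deriv isOpen_ball).continuousOn continuousOn_const Set.inter_subset_left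
      ((dense_compl_singleton (0 : ℂ)).open_subset_closure_inter isOpen_ball)
    exact (mul_eq_zero.1 (htW t ht.1)).resolve_left ht.2
  have h := isOpen_ball.is_const_of_deriv_eq_zero (convex_ball _ _).isPreconnected hW hder ht
    (mem_ball_self one_pos)
  have h0 : (0 : ℂ) ∈ ball (0 : ℂ) 1 := mem_ball_self one_pos
  simp only [W, ← eF t ht, ← eG t ht, ← eF 0 h0, ← eG 0 h0, besselF_zero, besselG_zero] at h
  linear_combination h

lemma y0_eq (z l : ℂ) : y0 z l = besselF (l⁻¹ ^ 2 * z ^ 4) := by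
  unfold y0 besselF besselCoeff
  congr 1; ext j
  rw [mul_pow, ← pow_mul, ← pow_mul]; ring

lemma y1_eq (z l : ℂ) : y1 z l = -2 * l⁻¹ * besselG (l⁻¹ ^ 2 * z ^ 4) := by
  unfold y1 besselG besselCoeff
  congr 2; ext j
  rw [mul_pow, ← pow_mul, ← pow_mul]; ring

lemma hasDerivAt_comp_quartic {F : ℂ → ℂ} (hF : DifferentiableOn ℂ F (ball 0 1)) {s z : ℂ}
    (h : s ^ 2 * z ^ 4 ∈ ball (0 : ℂ) 1) :
    HasDerivAt (fun ζ => F (s ^ 2 * ζ ^ 4))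
      (deriv F (s ^ 2 * z ^ 4) * (s ^ 2 * (4 * z ^ 3))) z := by
  have h1 := (hF.differentiableAt (isOpen_ball.mem_nhds h)).hasDerivAt
  have h2 : HasDerivAt (fun ζ : ℂ => s ^ 2 * ζ ^ 4) (s ^ 2 * (4 * z ^ 3)) z := by
    simpa using (hasDerivAt_pow 4 z).const_mul (s ^ 2)
  exact h1.comp z h2

lemma z_mul_deriv_y0 {z l : ℂ} (h : l⁻¹ ^ 2 * z ^ 4 ∈ ball (0 : ℂ) 1) :
    z * deriv (fun ζ => y0 ζ l) z =
      4 * (l⁻¹ ^ 2 * z ^ 4) * deriv besselF (l⁻¹ ^ 2 * z ^ 4) := by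
  simp only [y0_eq]
  rw [(hasDerivAt_comp_quartic differentiableOn_besselF h).deriv]; ring

lemma z_mul_deriv_y1 {z l : ℂ} (h : l⁻¹ ^ 2 * z ^ 4 ∈ ball (0 : ℂ) 1) :
    z * deriv (fun ζ => y1 ζ l) z =
      -2 * l⁻¹ * (4 * (l⁻¹ ^ 2 * z ^ 4) * deriv besselG (l⁻¹ ^ 2 * z ^ 4)) := by
  simp only [y1_eq]
  rw [((hasDerivAt_comp_quartic differentiableOn_besselG h).const_mul _).deriv]; ring

end Bessel

/-! ### The explicit middle factorization of the dressed solution -/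

section Explicit

open Metric

/-- The loop `N = B₀ M B₀⁻¹` as a function of `s = l⁻¹`, where `x = z⁴`, `B₀ = triangularPlus r` and
`M` is the factor of `L` without the logarithm. The conjugation by `B₀`, which has a pole in `s`,
still leaves a function holomorphic at `s = 0`; `dslope besselG 0 t` stands for `besselG t / t`. -/
noncomputable def conjugatedLoop (r x s : ℂ) : Matrix (Fin 2) (Fin 2) ℂ :=
  !![besselF (x * s ^ 2) + x * s ^ 2 * dslope besselG 0 (x * s ^ 2) / (2 * r ^ 2),
      s * x * (2 * deriv besselG (x * s ^ 2) + dslope besselG 0 (x * s ^ 2) / (2 * r ^ 2) +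
        4 * r ^ 2 * deriv besselF (x * s ^ 2));
    -(s * (x * s ^ 2 * dslope besselG 0 (x * s ^ 2) / (2 * r ^ 2))),
      besselF (x * s ^ 2) - 2 * (x * s ^ 2) * deriv besselG (x * s ^ 2) -
        x * s ^ 2 * dslope besselG 0 (x * s ^ 2) / (2 * r ^ 2)]

/-- The plus factor `B₀` of the leading part of the dressed solution. -/
noncomputable def triangularPlus (r l : ℂ) : Matrix (Fin 2) (Fin 2) ℂ := !![r, -l / r; 0, 1 / r]

/-- The product of the dressing matrix `[[c, -l/c], [0, 1/c]]`, the logarithmic factor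
`[[1, 0], [l⁻¹ e, 1]]` and the inverse of `triangularPlus r l`. -/
noncomputable def leadingPart (c e r l : ℂ) : Matrix (Fin 2) (Fin 2) ℂ :=
  !![(c - e / c) / r, l * (c - e / c) / r - l * r / c; e / (l * c * r), e / (c * r) + r / c]

lemma besselG_eq_mul_dslope (t : ℂ) : besselG t = t * dslope besselG 0 t := by
  have h := sub_smul_dslope besselG 0 t
  rw [besselG_zero, sub_zero, sub_zero, smul_eq_mul] at h
  exact h.symm

lemma besselF_eq_one_add (t : ℂ) : besselF t = 1 + t * dslope besselF 0 t := by
  have h := sub_smul_dslope besselF 0 t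
  rw [besselF_zero, sub_zero, smul_eq_mul] at h
  rw [h]; ring

lemma conjugatedLoop_zero (r x : ℂ) : conjugatedLoop r x 0 = 1 := by
  ext i j; fin_cases i <;> fin_cases j <;> simp [conjugatedLoop, besselF_zero]

lemma conjugatedLoop_neg (r x s : ℂ) : conjugatedLoop r x (-s) = sigma (conjugatedLoop r x s) := by
  ext i j
  rw [sigma_apply]
  fin_cases i <;> fin_cases j <;> simp [conjugatedLoop]

lemma det_conjugatedLoop {r x s : ℂ} (hr : r ≠ 0) (h : x * s ^ 2 ∈ ball (0 : ℂ) 1) :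
    (conjugatedLoop r x s).det = 1 := by
  have hW := bessel_wronskian h
  rw [besselG_eq_mul_dslope] at hW
  rw [conjugatedLoop, Matrix.det_fin_two_of]
  field_simp
  linear_combination 4 * r ^ 4 * hW

lemma differentiableOn_conjugatedLoop {r x : ℂ} (hx : ‖x‖ * 9 < 1) (i j : Fin 2) :
    DifferentiableOn ℂ (fun s => conjugatedLoop r x s i j) (ball 0 3) := by
  have hmaps : Set.MapsTo (fun s : ℂ => x * s ^ 2) (ball 0 3) (ball 0 1) := fun s hs => by
    rw [mem_ball_zero_iff] at *
    rw [norm_mul, norm_pow]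
    have : ‖s‖ ^ 2 ≤ 9 := by nlinarith [norm_nonneg s]
    nlinarith [norm_nonneg x]
  have hp : DifferentiableOn ℂ (fun s : ℂ => x * s ^ 2) (ball 0 3) := by fun_prop
  have hn : ball (0 : ℂ) 1 ∈ 𝓝 (0 : ℂ) := ball_mem_nhds _ one_pos
  have d1 := differentiableOn_besselF.comp hp hmaps
  have d2 := (differentiableOn_besselF.deriv isOpen_ball).comp hp hmaps
  have d3 := (differentiableOn_besselG.deriv isOpen_ball).comp hp hmaps
  have d4 := ((Complex.differentiableOn_dslope hn).2 differentiableOn_besselG).comp hp hmaps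
  simp only [Function.comp_def] at d1 d2 d3 d4
  fin_cases i <;> fin_cases j <;> simp [conjugatedLoop] <;> fun_prop

/-- `N` is within `O(|r|² |x|)` of the identity on the circle of radius `2`. -/
lemma exists_norm_conjugatedLoop_sub_one_le :
    ∃ C : ℝ, 1 ≤ C ∧ ∀ r x : ℂ, 1 ≤ ‖r‖ → ‖x‖ ≤ 1 / 9 → ∀ s ∈ sphere (0 : ℂ) 2, ∀ i j,
      ‖(conjugatedLoop r x s - 1) i j‖ ≤ 16 * C * (‖r‖ ^ 2 * ‖x‖) := by
  have hsub : closedBall (0 : ℂ) (1 / 2) ⊆ ball 0 1 := closedBall_subset_ball (by norm_num)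
  have hn : ball (0 : ℂ) 1 ∈ 𝓝 (0 : ℂ) := ball_mem_nhds _ one_pos
  have hbd : ∀ f : ℂ → ℂ, DifferentiableOn ℂ f (ball 0 1) →
      ∃ C, ∀ t ∈ closedBall (0 : ℂ) (1 / 2), ‖f t‖ ≤ C := fun f hf =>
    (isCompact_closedBall _ _).exists_bound_of_continuousOn (hf.continuousOn.mono hsub)
  obtain ⟨C1, h1⟩ := hbd _ ((Complex.differentiableOn_dslope hn).2 differentiableOn_besselF)
  obtain ⟨C2, h2⟩ := hbd _ ((Complex.differentiableOn_dslope hn).2 differentiableOn_besselG)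
  obtain ⟨C3, h3⟩ := hbd _ (differentiableOn_besselF.deriv isOpen_ball)
  obtain ⟨C4, h4⟩ := hbd _ (differentiableOn_besselG.deriv isOpen_ball)
  set C := max 1 (max (max C1 C2) (max C3 C4)) with hCdef
  have hC : 1 ≤ C := le_max_left _ _
  refine ⟨C, hC, fun r x hr hx s hs i j => ?_⟩
  rw [mem_sphere_zero_iff_norm] at hs
  set t := x * s ^ 2 with ht
  have htn : ‖t‖ = 4 * ‖x‖ := by rw [ht, norm_mul, norm_pow, hs]; ring
  have htb : t ∈ closedBall (0 : ℂ) (1 / 2) := by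
    rw [mem_closedBall_zero_iff, htn]; linarith
  have b1 : ‖dslope besselF 0 t‖ ≤ C := (h1 t htb).trans (by simp [hCdef])
  have b2 : ‖dslope besselG 0 t‖ ≤ C := (h2 t htb).trans (by simp [hCdef])
  have b3 : ‖deriv besselF t‖ ≤ C := (h3 t htb).trans (by simp [hCdef])
  have b4 : ‖deriv besselG t‖ ≤ C := (h4 t htb).trans (by simp [hCdef])
  have hr2 : 1 ≤ ‖r‖ ^ 2 := one_le_pow₀ hr
  have b2' : ‖dslope besselG 0 t / (2 * r ^ 2)‖ ≤ C := by
    rw [norm_div, norm_mul, norm_pow, Complex.norm_ofNat]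
    exact (div_le_self (norm_nonneg _) (by linarith)).trans b2
  have b3' : ‖4 * r ^ 2 * deriv besselF t‖ ≤ 4 * ‖r‖ ^ 2 * C := by
    rw [norm_mul, norm_mul, norm_pow, Complex.norm_ofNat]; gcongr
  have b4' : ‖2 * deriv besselG t‖ ≤ 2 * C := by
    rw [norm_mul, Complex.norm_ofNat]; gcongr
  have hx0 := norm_nonneg x
  have hCx : C * ‖x‖ ≤ C * (‖r‖ ^ 2 * ‖x‖) := by
    have := mul_le_mul_of_nonneg_right hr2 hx0
    rw [one_mul] at this
    gcongr
  fin_cases i <;> fin_cases j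
  · have e : (conjugatedLoop r x s - 1) 0 0 =
        t * (dslope besselF 0 t + dslope besselG 0 t / (2 * r ^ 2)) := by
      simp only [conjugatedLoop, ← ht, Matrix.sub_apply, besselF_eq_one_add t]
      simp; ring
    change ‖(conjugatedLoop r x s - 1) 0 0‖ ≤ _
    rw [e, norm_mul, htn]
    have := (norm_add_le _ _).trans (add_le_add b1 b2')
    calc _ ≤ 4 * ‖x‖ * (C + C) := by gcongr
      _ ≤ _ := by nlinarith
  · have e : (conjugatedLoop r x s - 1) 0 1 = s * x * (2 * deriv besselG t +
        dslope besselG 0 t / (2 * r ^ 2) + 4 * r ^ 2 * deriv besselF t) := by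
      simp [conjugatedLoop, ← ht]
    change ‖(conjugatedLoop r x s - 1) 0 1‖ ≤ _
    rw [e, norm_mul, norm_mul, hs]
    have := norm_add₃_le.trans (add_le_add (add_le_add b4' b2') b3')
    calc _ ≤ 2 * ‖x‖ * (2 * C + C + 4 * ‖r‖ ^ 2 * C) := by gcongr
      _ ≤ _ := by nlinarith
  · have e : (conjugatedLoop r x s - 1) 1 0 = -(s * (t * (dslope besselG 0 t / (2 * r ^ 2)))) := by
      simp [conjugatedLoop, ← ht, mul_div_assoc]
    change ‖(conjugatedLoop r x s - 1) 1 0‖ ≤ _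
    rw [e, norm_neg, norm_mul, norm_mul, htn, hs]
    calc _ ≤ 2 * (4 * ‖x‖ * C) := by gcongr
      _ ≤ _ := by nlinarith
  · have e : (conjugatedLoop r x s - 1) 1 1 = t * (dslope besselF 0 t - 2 * deriv besselG t -
        dslope besselG 0 t / (2 * r ^ 2)) := by
      simp only [conjugatedLoop, ← ht, Matrix.sub_apply, besselF_eq_one_add t]
      simp; ring
    change ‖(conjugatedLoop r x s - 1) 1 1‖ ≤ _
    rw [e, norm_mul, htn]
    have := (norm_sub_le _ _).trans
      (add_le_add ((norm_sub_le _ _).trans (add_le_add b1 b4')) b2')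
    calc _ ≤ 4 * ‖x‖ * (C + 2 * C + C) := by gcongr
      _ ≤ _ := by nlinarith

lemma sqrtNeg_eq {a : ℝ} (ha : 0 < a) : sqrtNeg a = Complex.I * (Real.sqrt a : ℂ) := by
  have h := Complex.ofReal_cpow_of_nonpos (x := -a) (by linarith) (1 / 2 : ℂ)
  rw [Complex.ofReal_neg, neg_neg] at h
  rw [sqrtNeg, h, mul_comm, Real.sqrt_eq_rpow, Complex.ofReal_cpow ha.le]
  congr 1
  · rw [show (Real.pi : ℂ) * Complex.I * (1 / 2) = Real.pi / 2 * Complex.I by ring,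
      Complex.exp_pi_div_two_mul_I]
  · push_cast; rfl

lemma phi_eq {a : ℝ} {z l r : ℂ} (hr : r ≠ 0) (hs : sqrtNeg a ≠ 0) (hl : l ≠ 0)
    (h : z ^ 4 * l⁻¹ ^ 2 ∈ ball (0 : ℂ) 1) :
    phi a z l = leadingPart (sqrtNeg a) (Complex.log (z / 2)) r l *
      conjugatedLoop r (z ^ 4) l⁻¹ * triangularPlus r l := by
  have h' : l⁻¹ ^ 2 * z ^ 4 ∈ ball (0 : ℂ) 1 := by rwa [mul_comm]
  have e0 : l * z * deriv (fun ζ => y0 ζ l) z = l * (z * deriv (fun ζ => y0 ζ l) z) := by ring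
  have e1 : l * z * (1 / 4) * deriv (fun ζ => y1 ζ l) z =
      l / 4 * (z * deriv (fun ζ => y1 ζ l) z) := by ring
  rw [phi, L, e0, e1, z_mul_deriv_y0 h', z_mul_deriv_y1 h', y0_eq, y1_eq,
    besselG_eq_mul_dslope, mul_comm (l⁻¹ ^ 2)]
  simp only [conjugatedLoop, leadingPart, triangularPlus]
  generalize besselF (z ^ 4 * l⁻¹ ^ 2) = f
  generalize deriv besselF (z ^ 4 * l⁻¹ ^ 2) = f'
  generalize deriv besselG (z ^ 4 * l⁻¹ ^ 2) = g'
  generalize dslope besselG 0 (z ^ 4 * l⁻¹ ^ 2) = g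
  generalize Complex.log (z / 2) = e
  generalize sqrtNeg a = c at *
  ext i j
  fin_cases i <;> fin_cases j <;>
    simp [Matrix.mul_apply, Fin.sum_univ_two] <;> field_simp <;> ring

lemma triangularPlus_neg (r l : ℂ) : triangularPlus r (-l) = sigma (triangularPlus r l) := by
  ext i j
  rw [sigma_apply]
  fin_cases i <;> fin_cases j <;> simp [triangularPlus, neg_div]

lemma det_triangularPlus {r : ℂ} (hr : r ≠ 0) (l : ℂ) : (triangularPlus r l).det = 1 := by
  simp [triangularPlus, hr]

lemma leadingPart_neg (c e r l : ℂ) : leadingPart c e r (-l) = sigma (leadingPart c e r l) := by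
  ext i j
  rw [sigma_apply]
  fin_cases i <;> fin_cases j <;> simp [leadingPart, div_neg]; ring

lemma det_leadingPart {c r l : ℂ} (hc : c ≠ 0) (hr : r ≠ 0) (hl : l ≠ 0) (e : ℂ) :
    (leadingPart c e r l).det = 1 := by
  rw [leadingPart, Matrix.det_fin_two_of]
  field_simp
  ring

/-- The relation `|r|² = -(a + 2 Re e)` makes the leading part anti-unitary for `J`: this is where
the middle term `w` comes from. -/
lemma leadingPart_conj {c e : ℂ} {r : ℝ} {a : ℝ} (l : Circle) (hr : r ≠ 0) (hc0 : c ≠ 0)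
    (hc : star c = -c) (hc2 : c ^ 2 = -a) (hre : r ^ 2 = -(a + 2 * e.re)) :
    (leadingPart c e r l)ᴴ * J * leadingPart c e r l = -J := by
  have hl : starRingEnd ℂ (l : ℂ) = (l : ℂ)⁻¹ := by
    rw [← Circle.coe_inv, Circle.coe_inv_eq_conj]
  have hl0 : (l : ℂ) ≠ 0 := l.coe_ne_zero
  have hrr : starRingEnd ℂ (r : ℂ) = r := Complex.conj_ofReal r
  have hr' : (r : ℂ) ≠ 0 := by exact_mod_cast hr
  have hsum : (r : ℂ) ^ 2 = c ^ 2 - (e + starRingEnd ℂ e) := by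
    rw [Complex.add_conj, hc2, ← Complex.ofReal_pow, hre]; push_cast; ring
  replace hc : starRingEnd ℂ c = -c := hc
  generalize (l : ℂ) = l' at *
  generalize (r : ℂ) = r' at *
  ext i j
  fin_cases i <;> fin_cases j <;>
    simp [leadingPart, J, Matrix.mul_apply, Fin.sum_univ_two, hl, hc, hrr] <;>
    field_simp
  · linear_combination c ^ 2 * hsum
  · linear_combination l' * c ^ 2 * hsum
  · linear_combination c ^ 2 * hsum
  · linear_combination c ^ 2 * hsum

end Explicit

/-! ### Assembly of the Iwasawa factorization -/

section Assembly

open Metric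

lemma sigma_mul (X Y : Matrix (Fin 2) (Fin 2) ℂ) : sigma (X * Y) = sigma X * sigma Y :=
  map_mul sigmaHom X Y

lemma sigma_neg (X : Matrix (Fin 2) (Fin 2) ℂ) : sigma (-X) = -sigma X :=
  map_neg sigmaHom X

lemma adjugate_sigma (X : Matrix (Fin 2) (Fin 2) ℂ) : (sigma X).adjugate = sigma X.adjugate := by
  ext i j
  rw [sigma_apply, Matrix.adjugate_fin_two, Matrix.adjugate_fin_two]
  fin_cases i <;> fin_cases j <;> simp [sigma_apply]

lemma w_neg (l : ℂ) : w (-l) = sigma (w l) := by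
  ext i j
  rw [sigma_apply]
  fin_cases i <;> fin_cases j <;> simp [w]

lemma w_mul_w {l : ℂ} (hl : l ≠ 0) : w l * w l = -1 := by
  ext i j
  fin_cases i <;> fin_cases j <;> simp [w, hl]

lemma det_w {l : ℂ} (hl : l ≠ 0) : (w l).det = 1 := by
  simp [w, hl]

/-- The middle term exchanges the two signs of the form `J`. -/
lemma w_conj (l : Circle) : (w l)ᴴ * J * w l = -J := by
  have hl : starRingEnd ℂ (l : ℂ) = (l : ℂ)⁻¹ := by
    rw [← Circle.coe_inv, Circle.coe_inv_eq_conj]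
  ext i j
  fin_cases i <;> fin_cases j <;>
    simp [w, J, Matrix.mul_apply, Fin.sum_univ_two, hl, l.coe_ne_zero]

lemma differentiableOn_mul_apply {X Y : ℂ → Matrix (Fin 2) (Fin 2) ℂ} {U : Set ℂ}
    (hX : ∀ i j, DifferentiableOn ℂ (fun l => X l i j) U)
    (hY : ∀ i j, DifferentiableOn ℂ (fun l => Y l i j) U) (i j : Fin 2) :
    DifferentiableOn ℂ (fun l => (X l * Y l) i j) U := by
  simp only [Matrix.mul_apply, Fin.sum_univ_two]
  exact ((hX i 0).mul (hY 0 j)).add ((hX i 1).mul (hY 1 j))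

lemma differentiableOn_adjugate_apply {X : ℂ → Matrix (Fin 2) (Fin 2) ℂ} {U : Set ℂ}
    (hX : ∀ i j, DifferentiableOn ℂ (fun l => X l i j) U) (i j : Fin 2) :
    DifferentiableOn ℂ (fun l => (X l).adjugate i j) U := by
  simp only [Matrix.adjugate_fin_two]
  fin_cases i <;> fin_cases j <;> simp [hX]

lemma contMDiff_circle_of_differentiableOn {g : ℂ → ℂ} {U : Set ℂ} (hU : IsOpen U)
    (hg : DifferentiableOn ℂ g U) (hc : ∀ l : Circle, (l : ℂ) ∈ U) :
    ContMDiff (𝓡 1) 𝓘(ℝ, ℂ) ∞ (fun l : Circle => g l) := by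
  have := finrank_real_complex_fact'
  have h1 : ContDiffOn ℝ ∞ g U := (hg.contDiffOn hU).restrict_scalars ℝ
  have h2 : ContMDiff (𝓡 1) 𝓘(ℝ, ℂ) ∞ (fun l : Circle => (l : ℂ)) :=
    contMDiff_coe_sphere (E := ℂ) (n := 1)
  exact h1.contMDiffOn.comp_contMDiff h2 hc

/-- The annulus on which the unitary factor is holomorphic. -/
def annulus : Set ℂ := ball 0 (3 / 2) ∩ {l | 1 / 3 < ‖l‖}

lemma isOpen_annulus : IsOpen annulus :=
  isOpen_ball.inter (isOpen_lt continuous_const continuous_norm)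

lemma circle_mem_annulus (l : Circle) : (l : ℂ) ∈ annulus := by
  simp [annulus, Circle.norm_coe]; norm_num

lemma ne_zero_of_mem_annulus {l : ℂ} (hl : l ∈ annulus) : l ≠ 0 := by
  rintro rfl
  have := hl.2
  simp at this
  linarith

/-- The factorization at a single point `z`: `hre` makes the leading part anti-unitary, and `hN`
allows the spectral factorization `Pᴴ J P = Nᴴ J N`. The factors are `B = P B₀` and
`F = -A N P⁻¹ w`, where `φ = A N B₀`. -/
lemma exists_factorization {a : ℝ} (ha : 0 < a) {z : ℂ} {r : ℝ} (hr : 0 < r)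
    (hre : r ^ 2 = -(a + 2 * (Complex.log (z / 2)).re)) (hz : ‖z ^ 4‖ * 9 < 1)
    (hN : ∀ s ∈ sphere (0 : ℂ) 2, ∀ i j, ‖(conjugatedLoop r (z ^ 4) s - 1) i j‖ ≤ 1 / 64) :
    ∃ F B : Circle → SL2C, F ∈ LoopSU11 ∧ B ∈ LoopSLPlusPos ∧
      ∀ l : Circle, phi a z l = (F l).1 * w l * (B l).1 := by
  have hrC : (r : ℂ) ≠ 0 := by exact_mod_cast hr.ne'
  have hsa : ((Real.sqrt a : ℝ) : ℂ) ^ 2 = a := by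
    rw [← Complex.ofReal_pow, Real.sq_sqrt ha.le]
  set c := sqrtNeg a with hcdef
  have hc := sqrtNeg_eq ha
  rw [← hcdef] at hc
  have hc2 : c ^ 2 = -a := by rw [hc, mul_pow, Complex.I_sq, hsa]; ring
  have hc0 : c ≠ 0 := by
    intro h
    rw [h] at hc2
    have : (a : ℂ) = 0 := by linear_combination hc2
    exact ha.ne' (by exact_mod_cast this)
  have hcs : star c = -c := by
    rw [hc]; simp
  have hball : ∀ l : Circle, z ^ 4 * (l : ℂ)⁻¹ ^ 2 ∈ ball (0 : ℂ) 1 := fun l => by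
    rw [mem_ball_zero_iff, norm_mul, norm_pow (l : ℂ)⁻¹, norm_inv, Circle.norm_coe]
    norm_num at hz ⊢
    linarith [pow_nonneg (norm_nonneg z) 4]
  set N := conjugatedLoop r (z ^ 4) with hNdef
  set A := leadingPart c (Complex.log (z / 2)) r with hAdef
  set B₀ := triangularPlus r with hB₀
  have hNd := differentiableOn_conjugatedLoop (r := r) hz
  have hNdet : ∀ l : Circle, (N (l : ℂ)⁻¹).det = 1 := fun l =>
    det_conjugatedLoop hrC (hball l)
  obtain ⟨P, hPd, hPσ, hPdet, ⟨ρ, hρ, hP0⟩, hPJ⟩ := exists_plus_factor hNd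
    (conjugatedLoop_zero _ _) (conjugatedLoop_neg _ _) hN hNdet
  have hcb : ∀ l : Circle, (l : ℂ) ∈ closedBall (0 : ℂ) 1 := fun l => by simp [Circle.norm_coe]
  have hcb' : ∀ l : Circle, (l : ℂ) ∈ ball (0 : ℂ) (3 / 2) := fun l => (circle_mem_annulus l).1
  have hsub : closedBall (0 : ℂ) 1 ⊆ ball 0 (3 / 2) := closedBall_subset_ball (by norm_num)
  -- The plus loop.
  have hB₀d : ∀ U : Set ℂ, ∀ i j, DifferentiableOn ℂ (fun l => B₀ l i j) U := fun U i j => by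
    fin_cases i <;> fin_cases j <;> simp [hB₀, triangularPlus]; fun_prop
  let Bm : ℂ → Matrix (Fin 2) (Fin 2) ℂ := fun l => P l * B₀ l
  have hBd : ∀ i j, DifferentiableOn ℂ (fun l => Bm l i j) (ball 0 (3 / 2)) :=
    differentiableOn_mul_apply hPd (hB₀d _)
  have hBdet : ∀ l ∈ closedBall (0 : ℂ) 1, (Bm l).det = 1 := fun l hl => by
    simp only [Bm, Matrix.det_mul, hPdet l hl, hB₀, det_triangularPlus hrC, one_mul]
  have hBσ : ∀ l : Circle, Bm (-l) = sigma (Bm l) := fun l => by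
    simp only [Bm, sigma_mul, hPσ _ (hcb' l), hB₀, triangularPlus_neg]
  -- The unitary loop, with `w⁻¹ = -w`.
  let Fm : ℂ → Matrix (Fin 2) (Fin 2) ℂ := fun l => -(A l * N l⁻¹ * (P l).adjugate * w l)
  have hFdet : ∀ l : Circle, (Fm l).det = 1 := fun l => by
    simp only [Fm, Matrix.det_neg, Matrix.det_mul, Matrix.det_adjugate, hNdet, hPdet _ (hcb l),
      hAdef, det_leadingPart hc0 hrC l.coe_ne_zero, det_w l.coe_ne_zero]
    simp
  have hAd : ∀ i j, DifferentiableOn ℂ (fun l => A l i j) annulus := fun i j => by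
    have h0 : ∀ l ∈ annulus, l * c * r ≠ 0 := fun l hl =>
      mul_ne_zero (mul_ne_zero (ne_zero_of_mem_annulus hl) hc0) hrC
    fin_cases i <;> fin_cases j <;> simp [hAdef, leadingPart] <;> fun_prop (disch := assumption)
  have hwd : ∀ i j, DifferentiableOn ℂ (fun l => w l i j) annulus := fun i j => by
    have h0 : ∀ l ∈ annulus, l ≠ 0 := fun l hl => ne_zero_of_mem_annulus hl
    fin_cases i <;> fin_cases j <;> simp [w] <;> fun_prop (disch := assumption)
  have hNd' : ∀ i j, DifferentiableOn ℂ (fun l => N l⁻¹ i j) annulus := fun i j => by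
    refine (hNd i j).comp (t := ball 0 3)
      (differentiableOn_inv.mono fun l hl => ne_zero_of_mem_annulus hl) fun l hl => ?_
    have h1 : 1 / 3 < ‖l‖ := hl.2
    rw [mem_ball_zero_iff, norm_inv]
    exact inv_lt_of_inv_lt₀ (by norm_num) (by linarith)
  have hPd' : ∀ i j, DifferentiableOn ℂ (fun l => P l i j) annulus := fun i j =>
    (hPd i j).mono Set.inter_subset_left
  have hFd : ∀ i j, DifferentiableOn ℂ (fun l => Fm l i j) annulus := fun i j =>
    (differentiableOn_mul_apply (differentiableOn_mul_apply (differentiableOn_mul_apply hAd hNd')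
      (differentiableOn_adjugate_apply hPd')) hwd i j).neg
  have hFσ : ∀ l : Circle, Fm (-l) = sigma (Fm l) := fun l => by
    simp only [Fm, sigma_mul, sigma_neg, hPσ _ (hcb' l), adjugate_sigma, w_neg, inv_neg,
      hAdef, leadingPart_neg, hNdef, conjugatedLoop_neg]
  have hPadj : ∀ l : Circle, (P l) * (P l).adjugate = 1 := fun l => by
    rw [Matrix.mul_adjugate, hPdet _ (hcb l), one_smul]
  have hadjP : ∀ l : Circle, (P l).adjugate * P l = 1 := fun l => by
    rw [Matrix.adjugate_mul, hPdet _ (hcb l), one_smul]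
  have hFJ : ∀ l : Circle, (Fm l)ᴴ * J * Fm l = J := fun l => by
    have hA := leadingPart_conj l hr.ne' hc0 hcs hc2 hre
    have hP := hPJ l
    have hw := w_conj l
    have hPP := hPadj l
    have hPP' : (P l).adjugateᴴ * (P l)ᴴ = 1 := by
      rw [← Matrix.conjTranspose_mul, hPP, Matrix.conjTranspose_one]
    calc (Fm l)ᴴ * J * Fm l
        = (w l)ᴴ * (P l).adjugateᴴ * (N (l : ℂ)⁻¹)ᴴ * ((A l)ᴴ * J * A l) * N (l : ℂ)⁻¹ *
            (P l).adjugate * w l := by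
          simp only [Fm, Matrix.conjTranspose_neg, Matrix.conjTranspose_mul]; noncomm_ring
      _ = -((w l)ᴴ * (P l).adjugateᴴ * ((N (l : ℂ)⁻¹)ᴴ * J * N (l : ℂ)⁻¹) *
            (P l).adjugate * w l) := by
          rw [hAdef, hA]; noncomm_ring
      _ = -((w l)ᴴ * ((P l).adjugateᴴ * (P l)ᴴ) * J * (P l * (P l).adjugate) * w l) := by
          rw [← hP]; noncomm_ring
      _ = J := by rw [hPP, hPP', mul_one, mul_one, hw, neg_neg]
  have hprod : ∀ l : Circle, phi a z l = Fm l * w l * Bm l := fun l => by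
    rw [phi_eq hrC hc0 l.coe_ne_zero (hball l)]
    have e : Fm l * w l * Bm l =
        -(A l * N (l : ℂ)⁻¹ * (P l).adjugate * (w l * w l) * P l * B₀ l) := by
      simp only [Fm, Bm]; noncomm_ring
    rw [e, w_mul_w l.coe_ne_zero]
    have e2 : -(A l * N (l : ℂ)⁻¹ * (P l).adjugate * (-1) * P l * B₀ l) =
        A l * N (l : ℂ)⁻¹ * ((P l).adjugate * P l) * B₀ l := by noncomm_ring
    rw [e2, hadjP, mul_one]
  classical
  let Γ : ℂ → SL2C := fun l => if h : l ∈ closedBall (0 : ℂ) 1 then ⟨Bm l, hBdet l h⟩ else 1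
  have hΓ : ∀ l ∈ closedBall (0 : ℂ) 1, (Γ l).1 = Bm l := fun l hl => by
    have h : Γ l = ⟨Bm l, hBdet l hl⟩ := dif_pos hl
    rw [h]
  refine ⟨fun l => ⟨Fm l, hFdet l⟩, fun l => ⟨Bm l, hBdet l (hcb l)⟩,
    ⟨⟨fun i j => ?_, fun l => ?_⟩, fun l => hFJ l⟩,
    ⟨⟨fun i j => ?_, fun l => ?_⟩, Γ, ⟨fun i j => ?_, fun l => ?_⟩, ρ * r, mul_pos hρ hr, ?_⟩,
    hprod⟩
  · exact contMDiff_circle_of_differentiableOn isOpen_annulus (hFd i j) circle_mem_annulus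
  · exact hFσ l
  · exact contMDiff_circle_of_differentiableOn isOpen_ball (hBd i j) hcb'
  · exact hBσ l
  · have h := ((hBd i j).mono hsub).diffContOnCl_ball subset_rfl
    have heq : Set.EqOn (fun l => (Γ l).1 i j) (fun l => Bm l i j) (closedBall 0 1) :=
      fun l hl => by simp only [hΓ l hl]
    refine ⟨h.1.congr fun l hl => heq (ball_subset_closedBall hl), h.2.congr fun l hl => heq ?_⟩
    rwa [closure_ball _ one_ne_zero] at hl
  · exact Subtype.ext (hΓ l (hcb l))
  · rw [hΓ 0 (by simp)]
    simp only [Bm, hP0, hB₀, triangularPlus]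
    ext i j
    fin_cases i <;> fin_cases j <;> simp [mul_comm]

end Assembly

end IwasawaSmyth

theorem mainTheorem8 (a : ℝ) (ha : 0 < a) :
    ∃ U ∈ 𝓝 (0 : ℂ), ∃ F B : ℂ → Circle → IwasawaSmyth.SL2C,
      ∀ z ∈ U ∩ Complex.slitPlane,
        F z ∈ IwasawaSmyth.LoopSU11 ∧ B z ∈ IwasawaSmyth.LoopSLPlusPos ∧
        ∀ l : Circle,
          IwasawaSmyth.phi a z l = (F z l).1 * IwasawaSmyth.w l * (B z l).1 := by
  obtain ⟨C, hC, hbound⟩ := IwasawaSmyth.exists_norm_conjugatedLoop_sub_one_le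
  -- The first bound makes `N` close to `1`, the second one makes `T = -(a + 2 log |z/2|) ≥ 1`.
  set δ := min (1 / (4096 * C)) (2 * Real.exp (-(1 + a) / 2)) with hδ
  have hδ0 : 0 < δ := by positivity
  have key : ∀ z ∈ Metric.ball (0 : ℂ) δ ∩ Complex.slitPlane,
      ∃ F B : Circle → IwasawaSmyth.SL2C,
        F ∈ IwasawaSmyth.LoopSU11 ∧ B ∈ IwasawaSmyth.LoopSLPlusPos ∧
        ∀ l : Circle, IwasawaSmyth.phi a z l = (F l).1 * IwasawaSmyth.w l * (B l).1 := by
    rintro z ⟨hzδ, hz⟩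
    rw [mem_ball_zero_iff] at hzδ
    have hz0 : 0 < ‖z‖ := norm_pos_iff.2 (Complex.slitPlane_ne_zero hz)
    have h1 : ‖z‖ * (4096 * C) < 1 := by
      have := hzδ.trans_le (min_le_left _ _)
      rwa [lt_div_iff₀ (by positivity)] at this
    have hz1 : ‖z‖ < 1 / 4096 := by nlinarith
    set T := -(a + 2 * (Complex.log (z / 2)).re) with hT
    have hlog : (Complex.log (z / 2)).re = Real.log (‖z‖ / 2) := by
      rw [Complex.log_re, norm_div, Complex.norm_ofNat]
    have hT1 : 1 ≤ T := by
      have h2 : ‖z‖ / 2 < Real.exp (-(1 + a) / 2) := by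
        have := hzδ.trans_le (min_le_right _ _)
        linarith
      have := (Real.log_lt_iff_lt_exp (by positivity)).2 h2
      rw [hT, hlog]; linarith
    have hT2 : T * ‖z‖ ≤ 4 := by
      have h2 : Real.log (2 / ‖z‖) ≤ 2 / ‖z‖ :=
        (Real.log_le_sub_one_of_pos (by positivity)).trans (by linarith)
      have h3 : Real.log (‖z‖ / 2) = -Real.log (2 / ‖z‖) := by
        rw [← Real.log_inv, inv_div]
      have h4 : T ≤ 4 / ‖z‖ := by
        rw [hT, hlog, h3]
        have : 4 / ‖z‖ = 2 * (2 / ‖z‖) := by ring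
        rw [this]; linarith
      rwa [le_div_iff₀ hz0] at h4
    have hr : 0 < Real.sqrt T := Real.sqrt_pos.2 (by linarith)
    have hr1 : 1 ≤ ‖((Real.sqrt T : ℝ) : ℂ)‖ := by
      rw [Complex.norm_real, Real.norm_eq_abs, abs_of_pos hr]
      exact Real.one_le_sqrt.2 hT1
    have hr2 : ‖((Real.sqrt T : ℝ) : ℂ)‖ ^ 2 = T := by
      rw [Complex.norm_real, Real.norm_eq_abs, sq_abs, Real.sq_sqrt (by linarith)]
    have hz3 : ‖z‖ ^ 3 ≤ ‖z‖ := pow_le_of_le_one hz0.le (by linarith) (by norm_num)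
    have hz4 : ‖z ^ 4‖ ≤ ‖z‖ := by
      rw [norm_pow]; exact pow_le_of_le_one hz0.le (by linarith) (by norm_num)
    refine IwasawaSmyth.exists_factorization ha hr (Real.sq_sqrt (by linarith)) (by linarith)
      fun s hs i j => (hbound _ _ hr1 (by linarith) s hs i j).trans ?_
    rw [hr2, norm_pow]
    have h5 : T * ‖z‖ ^ 4 ≤ 4 * ‖z‖ := by
      calc T * ‖z‖ ^ 4 = T * ‖z‖ * ‖z‖ ^ 3 := by ring
        _ ≤ 4 * ‖z‖ := by gcongr
    nlinarith
  choose! F B hFB using key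
  exact ⟨Metric.ball 0 δ, Metric.ball_mem_nhds _ hδ0, F, B, hFB⟩
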